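/- Let $\mathbb K$ be a finite field with $q$ elements and, for $n\ge 0$, let $U_n=U_n(\mathbb K)$ be the group of $n\times n$ upper unitriangular matrices, $\mathfrak n_n=\{u-1:u\in U_n\}$ the space of strictly upper triangular matrices, and $U_n\hookrightarrow U_{n+1}$ the embedding $A\mapsto\mathrm{diag}(A,1)$. *Set partitions.* For a set partition $\pi\vdash[n]$ let $D(\pi)$ be its set of arcs: the pairs $i<j$ lying in the same block of $\pi$ with no element $k$ of that block satisfying $i<k<j$. *Supercharacters.* Fix a nontrivial additive character $\theta:\mathbb K\to\mathbb C^\times$. For $\pi\vdash[n]$ and $c:D(\pi)\to\mathbb K^\times$ let $\lambda_{\pi,c}(x)=\sum_{(i,j)\in D(\pi)}c_{i,j}\,x_{i,j}$, a linear functional on $\mathfrak n_n$, let $\lambda_{\pi,c}U_n$ and $U_n\lambda_{\pi,c}U_n$ be its orbits under $\lambda\mapsto\lambda(\,\cdot\; b)$ and $\lambda\mapsto\lambda(a\,\cdot\, b)$ $(a,b\in U_n)$, and put $$\chi^{\pi}(u)=\sum_{c:D(\pi)\to\mathbb K^\times}\frac{|\lambda_{\pi,c}U_n|}{|U_n\lambda_{\pi,c}U_n|}\sum_{\mu\in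 U_n\lambda_{\pi,c}U_n}\theta\big(\mu(u-1)\big),\qquad u\in U_n .$$ These are the supercharacters of the Bergeron–Thiem supercharacter theory of $U_n$; its superclasses are the classes of the relation $g\sim h\iff h-1=a(g-1)b$ for some invertible upper triangular matrices $a,b$; write $[g]$ for the superclass of $g$. With $\langle\varphi,\psi\rangle=|G|^{-1}\sum_{g\in G}\overline{\varphi(g)}\psi(g)$ for functions on a finite group $G$, the superplancherel measure on the set partitions of $[n]$ is $$\mathrm{SPl}_n(\pi)=\frac{1}{|U_n|}\,\frac{\chi^\pi(1)^2}{\langle\chi^\pi,\chi^\pi\rangle}.$$ *Bratteli diagram.* The vertices of level $n\ge0$ are the set partitions of $[n]$; the edge between $\lambda\vdash[n]$ and $\Lambda\vdash[n+1]$ has multiplicity $$\kappa(\lambda,\Lambda)=\frac{\langle \mathrm{SInd}\,\chi^\lambda,\chi^\Lambda\rangle}{\langle\chi^\lambda,\chi^\lambda\rangle},\qquad \mathrm{SInd}(\varphi)(g)=\frac{|U_{n+1}|}{|U_n|\,|[g]|}\sum_{k\in[g]\cap U_n}\varphi(k),$$ and $\lambda\nearrow\Lambda$ means $\kappa(\lambda,\Lambda)\ne0$.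 Let $\dim\emptyset=1$, $\dim\Lambda=\sum_{\lambda}\dim\lambda\;\kappa(\lambda,\Lambda)$, and let $$\mathrm{tr}(\lambda,\Lambda)=\frac{\dim\lambda\;\mathrm{SPl}_{n+1}(\Lambda)\,\kappa(\lambda,\Lambda)}{\dim\Lambda\;\mathrm{SPl}_n(\lambda)}$$ be the transition measure. A *path measure* is a probability measure $P$ on the space of infinite paths $\emptyset=\pi_0\nearrow\pi_1\nearrow\pi_2\nearrow\cdots$ (with the $\sigma$-algebra generated by the coordinates) such that $P(\pi_0=\lambda_0,\dots,\pi_N=\lambda_N)=\prod_{i<N}\mathrm{tr}(\lambda_i,\lambda_{i+1})$ for all $N$ and all $\lambda_i\vdash[i]$. *Measures on the triangle.* Let $\Delta=\{(x,y)\in[0,1]^2: x\le y\}$. To $\pi\vdash[n]$ associate the subprobability on $\Delta$ $$\mu_\pi=\frac1n\sum_{(i,j)\in D(\pi)}\lambda_{A_{i,j}},\qquad A_{i,j}=\Big[\tfrac{i-1}{n},\tfrac in\Big]\times\Big[\tfrac{j-1}{n},\tfrac jn\Big],$$ where $\lambda_A$ is the uniform probability measure on $A$. Let $\Omega$ be the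 uniform measure of total mass $1/2$ on the segment $\{(x,1-x):x\in[0,1/2]\}\subset\Delta$. **Theorem.** (1) There is exactly one path measure $P$; for every $n$ its $n$-th coordinate $\pi_n$ has law $\mathrm{SPl}_n$; and for $P$-almost every path $(\pi_n)$ the measures $\mu_{\pi_n}$ converge to $\Omega$ in the weak* topology of finite measures on $\Delta$, i.e. $\int f\,d\mu_{\pi_n}\to\int f\,d\Omega$ for every continuous $f:\Delta\to\mathbb R$. (2) More generally, if $(\pi_n)_{n\ge1}$ are random set partitions, $\pi_n\vdash[n]$, defined on any common probability space, such that $\pi_n$ has law $\mathrm{SPl}_n$ for every $n\ge1$, then almost surely $\mu_{\pi_n}\to\Omega$ in the weak* topology. -/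

import Mathlib

open MeasureTheory Filter Topology
open scoped NNReal ENNReal

noncomputable section

namespace SuperPlancherel

/-! ### Set partitions of `[n]`, arcs, the associated measures -/

/-- Set partitions of an `n`-element linearly ordered set (`Fin n` plays the role of `[n]`). -/
abbrev SetPartition (n : ℕ) : Type := Finpartition (Finset.univ : Finset (Fin n))

/-- The finite set of set partitions carries the discrete σ-algebra. -/
instance (n : ℕ) : MeasurableSpace (SetPartition n) := ⊤

/-- The set `D(π)` of arcs: pairs `i < j` of consecutive elements of a block. -/
def arcs {n : ℕ} (π : SetPartition n) : Finset (Fin n × Fin n) :=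
  {a | a.1 < a.2 ∧ π.part a.1 = π.part a.2 ∧
    ∀ k, a.1 < k → k < a.2 → π.part k ≠ π.part a.1}

/-- The triangle `Δ = {(x, y) ∈ [0,1]² : x ≤ y}`. -/
def triangle : Set (ℝ × ℝ) := {p | p.1 ∈ Set.Icc 0 1 ∧ p.2 ∈ Set.Icc 0 1 ∧ p.1 ≤ p.2}

/-- The square `A_{i,j}` of side `1/n` (with `0`-based indices). -/
def square {n : ℕ} (i j : Fin n) : Set (ℝ × ℝ) :=
  Set.Icc ((i : ℝ) / n) (((i : ℝ) + 1) / n) ×ˢ Set.Icc ((j : ℝ) / n) (((j : ℝ) + 1) / n)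

/-- `μ_π = (1/n) ∑_{(i,j) ∈ D(π)} λ_{A_{i,j}}` as a measure on the plane, where `λ_A` is the
uniform probability measure on `A`. -/
def planeMeasure {n : ℕ} (π : SetPartition n) : Measure (ℝ × ℝ) :=
  (n : ℝ≥0)⁻¹ • ∑ a ∈ arcs π, ProbabilityTheory.cond volume (square a.1 a.2)

/-- The uniform measure of total mass `1/2` on the segment `{(x, 1 - x) : x ∈ [0, 1/2]}`. -/
def planeLimit : Measure (ℝ × ℝ) :=
  Measure.map (fun x : ℝ => (x, 1 - x)) (volume.restrict (Set.Icc 0 (1 / 2)))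

instance {n : ℕ} (π : SetPartition n) : IsFiniteMeasure (planeMeasure π) := by
  unfold planeMeasure
  infer_instance

instance : IsFiniteMeasure planeLimit := by
  unfold planeLimit
  infer_instance

/-- The measure on `Δ` induced by a finite measure on the plane (used for measures
concentrated on `Δ`). -/
def onTriangle (μ : Measure (ℝ × ℝ)) [IsFiniteMeasure μ] : FiniteMeasure triangle :=
  ⟨μ.comap Subtype.val, ⟨by
    have hT : MeasurableSet triangle :=
      (measurable_fst measurableSet_Icc).inter
        ((measurable_snd measurableSet_Icc).inter
          (measurableSet_le measurable_fst measurable_snd))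
    rw [comap_subtype_coe_apply hT]
    exact measure_lt_top μ _⟩⟩

/-- The subprobability `μ_π` on `Δ`. -/
def partitionMeasure {n : ℕ} (π : SetPartition n) : FiniteMeasure triangle :=
  onTriangle (planeMeasure π)

/-- The measure `Ω` on `Δ`. -/
def limitMeasure : FiniteMeasure triangle := onTriangle planeLimit

/-! ### Class-function formalism for a finite group with superclasses -/

section Groups

variable {H G : Type*} [Group H] [Fintype H] [Group G] [Fintype G]

/-- `⟨φ, ψ⟩ = |G|⁻¹ ∑_g conj (φ g) ψ g`. -/
def classInner (φ ψ : G → ℂ) : ℂ :=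
  (Fintype.card G : ℂ)⁻¹ * ∑ g, (starRingEnd ℂ) (φ g) * ψ g

/-- The superplancherel weight `χ(1)² / (|G| ⟨χ, χ⟩)` of a supercharacter `χ`. -/
def superPlancherelWeight (χ : G → ℂ) : ℂ :=
  χ 1 ^ 2 / ((Fintype.card G : ℂ) * classInner χ χ)

/-- Superinduction along an embedding `ι : H → G` of a function on `H`; the superclasses of `G`
are the classes of `scl`. -/
def superInd (scl : Setoid G) (ι : H →* G) (φ : H → ℂ) (g : G) : ℂ :=
  (Fintype.card G : ℂ) / ((Fintype.card H : ℂ) * ({k | scl g k} : Set G).ncard) *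
    ∑ᶠ k ∈ {k | scl g k}, Function.extend ι φ 0 k

end Groups

/-! ### The groups `U_n` -/

section Unitriangular

variable (K : Type*) [Field K] (n : ℕ)

/-- The group of invertible upper triangular matrices. -/
def upperTriangular : Subgroup (GL (Fin n) K) where
  carrier := {g | (g : Matrix (Fin n) (Fin n) K).BlockTriangular id}
  mul_mem' {a b} ha hb := by
    simpa using Matrix.BlockTriangular.mul ha hb
  one_mem' := by simpa using Matrix.blockTriangular_one
  inv_mem' {a} ha := by
    have := Matrix.blockTriangular_inv_of_blockTriangular (M := (a : Matrix (Fin n) (Fin n) K)) ha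
    simpa using this

variable {K n} in
lemma mul_diag {a b : Matrix (Fin n) (Fin n) K} (ha : a.BlockTriangular id)
    (hb : b.BlockTriangular id) (i : Fin n) : (a * b) i i = a i i * b i i := by
  rw [Matrix.mul_apply]
  refine Finset.sum_eq_single i (fun k _ hk => ?_) (by simp)
  rcases lt_or_gt_of_ne hk with h | h
  · rw [ha h, zero_mul]
  · rw [hb h, mul_zero]

/-- The group `U_n(K)` of upper unitriangular matrices. -/
def U : Subgroup (GL (Fin n) K) where
  carrier := {g | (g : Matrix (Fin n) (Fin n) K).BlockTriangular id ∧
    ∀ i, (g : Matrix (Fin n) (Fin n) K) i i = 1}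
  mul_mem' {a b} ha hb := by
    refine ⟨(upperTriangular K n).mul_mem ha.1 hb.1, fun i => ?_⟩
    rw [Units.val_mul, mul_diag ha.1 hb.1, ha.2, hb.2, mul_one]
  one_mem' := ⟨(upperTriangular K n).one_mem, fun i => by simp⟩
  inv_mem' {a} ha := by
    have h := (upperTriangular K n).inv_mem ha.1
    refine ⟨h, fun i => ?_⟩
    have h1 := mul_diag (K := K) ha.1 h i
    rw [← Units.val_mul, mul_inv_cancel, ha.2 i, one_mul] at h1
    simpa using h1.symm

instance [Finite K] : Fintype (U K n) := Fintype.ofFinite _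

/-- The space of strictly upper triangular matrices, i.e. `{u - 1 : u ∈ U_n(K)}`. -/
def strictUpper : Submodule K (Matrix (Fin n) (Fin n) K) where
  carrier := {x | ∀ i j, j ≤ i → x i j = 0}
  add_mem' {x y} hx hy i j h := by simp [hx i j h, hy i j h]
  zero_mem' _ _ _ := rfl
  smul_mem' c x hx i j h := by simp [hx i j h]

variable {K n}

lemma mul_mem_strictUpper_left {a x : Matrix (Fin n) (Fin n) K} (ha : a.BlockTriangular id)
    (hx : x ∈ strictUpper K n) : a * x ∈ strictUpper K n := by
  intro i j hij
  rw [Matrix.mul_apply]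
  refine Finset.sum_eq_zero fun k _ => ?_
  rcases lt_or_ge k i with h | h
  · rw [ha h, zero_mul]
  · rw [hx k j (hij.trans h), mul_zero]

lemma mul_mem_strictUpper_right {b x : Matrix (Fin n) (Fin n) K} (hb : b.BlockTriangular id)
    (hx : x ∈ strictUpper K n) : x * b ∈ strictUpper K n := by
  intro i j hij
  rw [Matrix.mul_apply]
  refine Finset.sum_eq_zero fun k _ => ?_
  rcases lt_or_ge j k with h | h
  · rw [hb h, mul_zero]
  · rw [hx i k (h.trans hij), zero_mul]

/-- The element `u - 1` of the space of strictly upper triangular matrices. -/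
def subOne (u : U K n) : strictUpper K n :=
  ⟨(u.1 : Matrix (Fin n) (Fin n) K) - 1, by
    intro i j hij
    rcases hij.lt_or_eq with h | rfl
    · have h1 : (u.1 : Matrix (Fin n) (Fin n) K) i j = 0 := u.2.1 h
      simp [h1, Matrix.one_apply_ne h.ne']
    · simp [u.2.2 j]⟩

/-- The linear map `x ↦ a x b` on strictly upper triangular matrices, for `a, b ∈ U_n(K)`. -/
def twoSided (a b : U K n) : strictUpper K n →ₗ[K] strictUpper K n where
  toFun x := ⟨(a.1 : Matrix (Fin n) (Fin n) K) * x.1 * (b.1 : Matrix (Fin n) (Fin n) K),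
    mul_mem_strictUpper_right b.2.1 (mul_mem_strictUpper_left a.2.1 x.2)⟩
  map_add' x y := by ext; simp [mul_add, add_mul]
  map_smul' c x := by ext; simp

/-- The orbit of a linear functional under the two-sided action of `U_n(K)`. -/
def twoSidedOrbit (l : Module.Dual K (strictUpper K n)) :
    Set (Module.Dual K (strictUpper K n)) :=
  {m | ∃ a b : U K n, m = l ∘ₗ twoSided a b}

/-- The orbit of a linear functional under the one-sided action of `U_n(K)`. -/
def oneSidedOrbit (l : Module.Dual K (strictUpper K n)) :
    Set (Module.Dual K (strictUpper K n)) :=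
  {m | ∃ b : U K n, m = l ∘ₗ twoSided 1 b}

/-- The functional `x ↦ ∑_{(i,j) ∈ D(π)} c_{i,j} x_{i,j}` of a coloured set partition. -/
def coloredFunctional (π : SetPartition n) (c : arcs π → Kˣ) :
    Module.Dual K (strictUpper K n) where
  toFun x := ∑ a : arcs π, (c a : K) * x.1 a.1.1 a.1.2
  map_add' x y := by simp [mul_add, Finset.sum_add_distrib]
  map_smul' r x := by simp [Finset.mul_sum, mul_left_comm]

/-- The superclasses of `U_n(K)`, as an equivalence relation: `g ∼ h` if `h - 1 = a (g - 1) b` with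
`a, b` invertible upper triangular. The classes are the sets
`K_π = ⋃_c K_{π,c}`, where `K_{π,c}` is the two-sided `U_n(K)`-orbit, shifted by `1`, of the matrix
with entries `c_{i,j} ≠ 0` at the arcs of `π` and `0` elsewhere. -/
def superclass (K : Type*) [Field K] (n : ℕ) : Setoid (U K n) where
  r g h := ∃ a ∈ upperTriangular K n, ∃ b ∈ upperTriangular K n,
    (h.1 : Matrix (Fin n) (Fin n) K) - 1 =
      (a : Matrix (Fin n) (Fin n) K) * ((g.1 : Matrix (Fin n) (Fin n) K) - 1) *
        (b : Matrix (Fin n) (Fin n) K)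
  iseqv :=
    { refl := fun g => ⟨1, one_mem _, 1, one_mem _, by simp⟩
      symm := by
        rintro g h ⟨a, ha, b, hb, e⟩
        refine ⟨a⁻¹, inv_mem ha, b⁻¹, inv_mem hb, ?_⟩
        rw [e, mul_assoc, mul_assoc, Units.mul_inv, mul_one, ← mul_assoc, Units.inv_mul, one_mul]
      trans := by
        rintro g h k ⟨a, ha, b, hb, e⟩ ⟨a', ha', b', hb', e'⟩
        refine ⟨a' * a, mul_mem ha' ha, b * b', mul_mem hb hb', ?_⟩
        rw [e', e, Units.val_mul, Units.val_mul]
        simp only [mul_assoc] }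

variable (K n) in
/-- The multiplicative map `A ↦ diag(A, 1)` from `n × n` to `(n+1) × (n+1)` matrices. -/
def extendMatrix : Matrix (Fin n) (Fin n) K →* Matrix (Fin (n + 1)) (Fin (n + 1)) K where
  toFun A := Matrix.reindex finSumFinEquiv finSumFinEquiv
    (Matrix.fromBlocks A 0 0 (1 : Matrix (Fin 1) (Fin 1) K))
  map_one' := by simp [Matrix.fromBlocks_one]
  map_mul' A B := by
    simp only [Matrix.reindex_apply, Matrix.submatrix_mul_equiv, Matrix.fromBlocks_multiply]
    simp

lemma extend_mem (u : U K n) :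
    Units.map (extendMatrix K n) u.1 ∈ U K (n + 1) := by
  have hc (i j : Fin n) : extendMatrix K n (u.1 : Matrix (Fin n) (Fin n) K)
      i.castSucc j.castSucc = (u.1 : Matrix (Fin n) (Fin n) K) i j := by
    have h (k : Fin n) : finSumFinEquiv.symm k.castSucc = (Sum.inl k : Fin n ⊕ Fin 1) :=
      finSumFinEquiv_symm_apply_castAdd k
    simp [extendMatrix, h]
  have hl : (finSumFinEquiv (m := n) (n := 1)).symm (Fin.last n) = Sum.inr 0 :=
    finSumFinEquiv_symm_apply_natAdd (m := n) (0 : Fin 1)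
  refine ⟨fun i j hij => ?_, fun i => ?_⟩
  · induction j using Fin.lastCases with
    | last => exact absurd hij (not_lt.2 (Fin.le_last i))
    | cast j =>
      induction i using Fin.lastCases with
      | last =>
        have h : finSumFinEquiv.symm j.castSucc = (Sum.inl j : Fin n ⊕ Fin 1) :=
          finSumFinEquiv_symm_apply_castAdd j
        simp [extendMatrix, h, hl]
      | cast i =>
        rw [Units.coe_map]
        exact (hc i j).trans (u.2.1 (Fin.castSucc_lt_castSucc_iff.1 hij))
  · induction i using Fin.lastCases with
    | last => simp [extendMatrix, hl]
    | cast i =>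
      rw [Units.coe_map]
      exact (hc i i).trans (u.2.2 i)

variable (K n) in
/-- The embedding `U_n(K) → U_{n+1}(K)`, `A ↦ diag(A, 1)`. -/
def embed : U K n →* U K (n + 1) :=
  ((Units.map (extendMatrix K n)).comp (U K n).subtype).codRestrict (U K (n + 1)) extend_mem

end Unitriangular

/-! ### Supercharacters, superplancherel measure, Bratteli diagram -/

section Main

variable {K : Type*} [Field K] [Fintype K] (θ : AddChar K ℂ)

/-- The supercharacter `χ^{π,c}` of a coloured set partition: with `l` the functional of `(π, c)`,
`χ^{π,c}(u) = |l U| / |U l U| ∑_{m ∈ U l U} θ (m (u - 1))`. -/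
def coloredSupercharacter {n : ℕ} (π : SetPartition n) (c : arcs π → Kˣ) (u : U K n) : ℂ :=
  ((oneSidedOrbit (coloredFunctional π c)).ncard : ℂ) /
      ((twoSidedOrbit (coloredFunctional π c)).ncard : ℂ) *
    ∑ᶠ m ∈ twoSidedOrbit (coloredFunctional π c), θ (m (subOne u))

open scoped Classical in
/-- The supercharacter `χ^π = ∑_c χ^{π,c}` of `U_n(K)` indexed by the set partition `π`. -/
def supercharacter {n : ℕ} (π : SetPartition n) (u : U K n) : ℂ :=
  ∑ c : arcs π → Kˣ, coloredSupercharacter θ π c u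

/-- The superplancherel measure `SPl_n(π)`. -/
def SPl {n : ℕ} (π : SetPartition n) : ℂ :=
  superPlancherelWeight (supercharacter θ π)

/-- The multiplicity `κ(l, L)` of an edge of the Bratteli diagram of set partitions. -/
def multiplicity {n : ℕ} (l : SetPartition n) (L : SetPartition (n + 1)) : ℂ :=
  classInner (superInd (superclass K (n + 1)) (embed K n) (supercharacter θ l)) (supercharacter θ L) /
    classInner (supercharacter θ l) (supercharacter θ l)

/-- The edge relation `l ↗ L`. -/
def IsEdge {n : ℕ} (l : SetPartition n) (L : SetPartition (n + 1)) : Prop :=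
  multiplicity θ l L ≠ 0

/-- The dimension of a vertex: the total weight of the paths from the root to the vertex. -/
def bratteliDim : (n : ℕ) → SetPartition n → ℂ
  | 0, _ => 1
  | n + 1, L => ∑ l : SetPartition n, bratteliDim n l * multiplicity θ l L

/-- The transition measure of the Bratteli diagram for the superplancherel measures. -/
def transition {n : ℕ} (l : SetPartition n) (L : SetPartition (n + 1)) : ℂ :=
  bratteliDim θ n l * SPl θ L * multiplicity θ l L / (bratteliDim θ (n + 1) L * SPl θ l)

/-- The space of infinite paths of the Bratteli diagram, starting at the root (the set partition
of the empty set); it carries the σ-algebra generated by the coordinates. -/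
abbrev InfinitePath : Type :=
  {w : (n : ℕ) → SetPartition n // ∀ n, IsEdge θ (w n) (w (n + 1))}

/-- `P` is the law on infinite paths of the Markov chain that starts at the root and has the
transition measures as transition probabilities. -/
def IsPathMeasure (P : Measure (InfinitePath θ)) : Prop :=
  IsProbabilityMeasure P ∧
    ∀ (N : ℕ) (l : (n : ℕ) → SetPartition n),
      ((P.real {w | ∀ i ≤ N, w.1 i = l i} : ℝ) : ℂ) =
        ∏ i ∈ Finset.range N, transition θ (l i) (l (i + 1))

end Main

end SuperPlancherel

end

/-!
The proof identifies the superplancherel measure with the law of a combinatorial statistic of a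
uniform random functional `l` on the space of strictly upper triangular matrices, and then counts.

Row and column operations bring every functional into the form `λ_{π,c}`
(`exists_mem_twoSidedOrbit`). The set partition `π`, called the `shape` of the functional, is
unique and invariant under all invertible upper triangular matrices, because the number of its arcs
in each north-east corner is read off from the size of the left kernel of that corner
(`ncard_leftKer`, `eq_of_card_freeRows`). Since the diagonal matrices act transitively on the
colourings `c`, the supercharacter `χ^π` is a positive multiple of `∑ θ (l (u - 1))` over all `l` of
shape `π` (`supercharacter_eq`). The functions `u ↦ θ (l (u - 1))` are orthonormal, so `SPl_n(π)` is
the proportion of functionals of shape `π` (`SPl_eq`).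

Frobenius reciprocity (`classInner_superInd`) turns the multiplicities of the Bratteli diagram into
counts of functionals of shape `L` whose restriction to the leading block has shape `l`. The
proportionality constants cancel, and the transition measure is the conditional probability of
the shape `L` given the shape `l` of the restriction (`transition_eq`). Hence it is a genuine
stochastic matrix for which the superplancherel measures are coherent. Existence of the path measure
is the Ionescu-Tulcea theorem, and uniqueness holds since cylinders determine the measure.

For the limit shape, a square north-east corner of a random functional has on average at most two
vectors in its left kernel (`sum_ncard_leftKer_le`). By Markov's inequality, outside an event
of probability at most `(n + 1) / 2 ^ t`, all but `t` of the first `i` elements of `[n]` are joined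
to one of the last `i` elements, for every `i ≤ n / 2`. With `t` of order `log n` these
probabilities are summable, and the Borel–Cantelli lemma applies to any coupling of the measures
(`ae_eventually_isNearAntidiagonal`). Such a set partition has almost one arc starting at each
element of the left half, almost none in the right half, and the total distance of its arcs to the
antidiagonal is `O(n t)` (`sum_dist_antidiagonal_le`), so that integrals against `μ_π` are close to
Riemann sums on the antidiagonal (`abs_integral_planeMeasure_sub_le`).
-/

namespace SuperPlancherel

/-! ### Set partitions and their arcs -/

section Arcs

variable {n : ℕ}

lemma mem_arcs {π : SetPartition n} {a b : Fin n} :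
    (a, b) ∈ arcs π ↔ a < b ∧ π.part a = π.part b ∧
      ∀ k, a < k → k < b → π.part k ≠ π.part a := by
  simp [arcs]

lemma arcs_right_unique {π : SetPartition n} {a b b' : Fin n} (h : (a, b) ∈ arcs π)
    (h' : (a, b') ∈ arcs π) : b = b' := by
  rw [mem_arcs] at h h'
  rcases lt_trichotomy b b' with hb | hb | hb
  · exact absurd h.2.1.symm (h'.2.2 b h.1 hb)
  · exact hb
  · exact absurd h'.2.1.symm (h.2.2 b' h'.1 hb)

lemma arcs_left_unique {π : SetPartition n} {a a' b : Fin n} (h : (a, b) ∈ arcs π)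
    (h' : (a', b) ∈ arcs π) : a = a' := by
  rw [mem_arcs] at h h'
  rcases lt_trichotomy a a' with ha | ha | ha
  · exact absurd (h'.2.1.trans h.2.1.symm) (h.2.2 a' ha h'.1)
  · exact ha
  · exact absurd (h.2.1.trans h'.2.1.symm) (h'.2.2 a ha h.1)

lemma part_eq_part_of_arcs_subset {π π' : SetPartition n} (h : arcs π ⊆ arcs π') (m : ℕ) :
    ∀ i j : Fin n, i < j → (j : ℕ) - i = m → π.part i = π.part j → π'.part i = π'.part j := by
  induction m using Nat.strong_induction_on with
  | _ m ih =>
    intro i j hij hm hp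
    by_cases hk : ∃ k, i < k ∧ k < j ∧ π.part k = π.part i
    · obtain ⟨k, hik, hkj, hk⟩ := hk
      rw [Fin.lt_def] at hik hkj
      exact (ih (k - i) (by omega) i k hik rfl hk.symm).trans
        (ih (j - k) (by omega) k j hkj rfl (hk.trans hp))
    · push Not at hk
      exact (mem_arcs.1 (h (mem_arcs.2 ⟨hij, hp, hk⟩))).2.1

lemma arcs_injective : Function.Injective (arcs : SetPartition n → Finset (Fin n × Fin n)) := by
  have key : ∀ π π' : SetPartition n, arcs π ⊆ arcs π' → ∀ i j, π.part i = π.part j →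
      π'.part i = π'.part j := by
    intro π π' h i j hp
    rcases lt_trichotomy i j with hij | rfl | hij
    · exact part_eq_part_of_arcs_subset h _ i j hij rfl hp
    · rfl
    · exact (part_eq_part_of_arcs_subset h _ j i hij rfl hp.symm).symm
  have hle : ∀ π π' : SetPartition n, arcs π = arcs π' → π.parts ⊆ π'.parts := by
    intro π π' h s hs
    obtain ⟨a, ha⟩ := π.nonempty_of_mem_parts hs
    have h1 : π.part a = s := π.part_eq_of_mem hs ha
    have h2 : π.part a = π'.part a := by
      ext b
      rw [π.mem_part_iff_part_eq_part (Finset.mem_univ _) (Finset.mem_univ _),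
        π'.mem_part_iff_part_eq_part (Finset.mem_univ _) (Finset.mem_univ _)]
      exact ⟨key π π' h.subset b a, key π' π h.superset b a⟩
    rw [← h1, h2]
    exact π'.part_mem.2 (Finset.mem_univ _)
  intro π π' h
  exact Finpartition.ext ((hle π π' h).antisymm (hle π' π h.symm))

/-- Every placement of non-attacking rooks strictly above the diagonal is the set of arcs of a set
partition: the blocks are the maximal chains of consecutive rooks. -/
lemma exists_arcs_eq (S : Finset (Fin n × Fin n)) (hlt : ∀ a b, (a, b) ∈ S → a < b)
    (hr : ∀ a b b', (a, b) ∈ S → (a, b') ∈ S → b = b')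
    (hl : ∀ a a' b, (a, b) ∈ S → (a', b) ∈ S → a = a') :
    ∃ π : SetPartition n, arcs π = S := by
  classical
  let r : Fin n → Fin n → Prop := fun a b => (a, b) ∈ S
  let R : Fin n → Fin n → Prop := Relation.ReflTransGen r
  have hru : Relator.RightUnique r := fun a b b' h h' => hr a b b' h h'
  have hlu : Relator.RightUnique (Function.swap r) := fun b a a' h h' => hl a a' b h h'
  have hle : ∀ {a b}, R a b → a ≤ b := by
    intro a b h
    induction h with
    | refl => exact le_rfl
    | tail _ h ih => exact ih.trans (hlt _ _ h).le
  let s : Setoid (Fin n) :=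
    { r := fun a b => R a b ∨ R b a
      iseqv :=
        { refl := fun a => Or.inl .refl
          symm := fun h => h.symm
          trans := by
            rintro a b c (h | h) (h' | h')
            · exact Or.inl (h.trans h')
            · rcases Relation.ReflTransGen.total_of_right_unique hlu
                (Relation.reflTransGen_swap.2 h) (Relation.reflTransGen_swap.2 h') with h | h
              · exact Or.inr (Relation.reflTransGen_swap.1 h)
              · exact Or.inl (Relation.reflTransGen_swap.1 h)
            · exact Relation.ReflTransGen.total_of_right_unique hru h h'
            · exact Or.inr (h'.trans h) } }
  refine ⟨Finpartition.ofSetoid s, ?_⟩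
  have hpart : ∀ a b, (Finpartition.ofSetoid s).part a = (Finpartition.ofSetoid s).part b ↔
      (R a b ∨ R b a) := by
    intro a b
    rw [← (Finpartition.ofSetoid s).mem_part_iff_part_eq_part (Finset.mem_univ _)
      (Finset.mem_univ _), Finpartition.mem_part_ofSetoid_iff_rel]
    exact Or.comm
  ext ⟨a, b⟩
  rw [mem_arcs]
  simp only [hpart, ne_eq]
  constructor
  · rintro ⟨hab, h, hk⟩
    have h : R a b := h.resolve_right fun h => absurd (hle h) (not_le.2 hab)
    rcases Relation.ReflTransGen.cases_head h with rfl | ⟨c, hac, hcb⟩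
    · exact absurd hab (lt_irrefl _)
    · rcases (hle hcb).eq_or_lt with rfl | hcb'
      · exact hac
      · exact absurd (Or.inr (.single hac)) (hk c (hlt _ _ hac) hcb')
  · intro h
    refine ⟨hlt _ _ h, Or.inl (.single h), fun k hak hkb hk => ?_⟩
    have hk : R a k := hk.resolve_left fun h => absurd (hle h) (not_le.2 hak)
    rcases Relation.ReflTransGen.cases_head hk with rfl | ⟨c, hac, hck⟩
    · exact absurd hak (lt_irrefl _)
    · rw [hr a c b hac h] at hck
      exact absurd (hle hck) (not_le.2 hkb)

end Arcs

/-! ### Linear functionals on strictly upper triangular matrices -/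

section Functionals

variable {K : Type*} [Field K] {n : ℕ}

/-- The projection of a matrix onto its strictly upper triangular part. -/
noncomputable def strictUpperPart : Matrix (Fin n) (Fin n) K →ₗ[K] strictUpper K n where
  toFun M := ⟨Matrix.of fun i j => if i < j then M i j else 0, fun i j h => by
    simp [not_lt.2 h]⟩
  map_add' x y := by ext i j; by_cases h : i < j <;> simp [h]
  map_smul' r x := by ext i j; by_cases h : i < j <;> simp [h]

lemma strictUpperPart_coe (x : strictUpper K n) : strictUpperPart x.1 = x := by
  ext i j
  by_cases h : i < j
  · simp [strictUpperPart, h]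
  · simp [strictUpperPart, h, x.2 i j (not_lt.1 h)]

lemma coe_strictUpperPart {M : Matrix (Fin n) (Fin n) K} (h : M ∈ strictUpper K n) :
    (strictUpperPart M).1 = M :=
  congrArg Subtype.val (strictUpperPart_coe ⟨M, h⟩)

/-- The elementary matrix `E_{a,b}`, read as `0` if it is not strictly upper triangular. -/
noncomputable def elem (a b : Fin n) : strictUpper K n :=
  strictUpperPart (Matrix.single a b 1)

lemma elem_of_le {a b : Fin n} (h : b ≤ a) : (elem a b : strictUpper K n) = 0 := by
  ext i j
  by_cases hij : i < j
  · have : ¬ (a = i ∧ b = j) := by rintro ⟨rfl, rfl⟩; exact absurd hij (not_lt.2 h)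
    simp [elem, strictUpperPart, this]
  · simp [elem, strictUpperPart, hij]

lemma single_mem_strictUpper {a b : Fin n} (h : a < b) (s : K) :
    Matrix.single a b s ∈ strictUpper K n := by
  intro i j hij
  have : ¬ (a = i ∧ b = j) := by rintro ⟨rfl, rfl⟩; exact absurd h (not_lt.2 hij)
  simp [this]

lemma coe_elem {a b : Fin n} (h : a < b) :
    (elem a b : strictUpper K n).1 = Matrix.single a b 1 :=
  coe_strictUpperPart (single_mem_strictUpper h 1)

lemma strictUpperPart_eq_sum (M : Matrix (Fin n) (Fin n) K) :
    strictUpperPart M = ∑ a, ∑ b, M a b • elem a b := by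
  conv_lhs => rw [Matrix.matrix_eq_sum_single M]
  simp only [map_sum]
  refine Finset.sum_congr rfl fun a _ => Finset.sum_congr rfl fun b _ => ?_
  rw [elem, ← map_smul, Matrix.smul_single, smul_eq_mul, mul_one]

lemma dual_apply_strictUpperPart (l : Module.Dual K (strictUpper K n))
    (M : Matrix (Fin n) (Fin n) K) :
    l (strictUpperPart M) = ∑ a, ∑ b, M a b * l (elem a b) := by
  simp [strictUpperPart_eq_sum, map_sum]

lemma dual_ext {l l' : Module.Dual K (strictUpper K n)}
    (h : ∀ a b, l (elem a b) = l' (elem a b)) : l = l' := by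
  ext x
  rw [← strictUpperPart_coe x, dual_apply_strictUpperPart, dual_apply_strictUpperPart]
  simp [h]

lemma coloredFunctional_apply (π : SetPartition n) (c : arcs π → Kˣ) (x : strictUpper K n) :
    coloredFunctional π c x = ∑ a : arcs π, (c a : K) * x.1 a.1.1 a.1.2 := rfl

lemma coloredFunctional_elem (π : SetPartition n) (c : arcs π → Kˣ) (a b : Fin n) :
    coloredFunctional π c (elem a b) = if h : (a, b) ∈ arcs π then (c ⟨(a, b), h⟩ : K) else 0 := by
  rcases lt_or_ge a b with hab | hab
  · rw [coloredFunctional_apply, coe_elem hab]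
    simp only [Matrix.single_apply]
    split_ifs with h
    · rw [Finset.sum_eq_single ⟨(a, b), h⟩]
      · simp
      · rintro ⟨⟨a', b'⟩, h'⟩ _ hne
        have : ¬ (a = a' ∧ b = b') := by rintro ⟨rfl, rfl⟩; exact hne rfl
        simp [this]
      · simp
    · refine Finset.sum_eq_zero ?_
      rintro ⟨⟨a', b'⟩, h'⟩ _
      have : ¬ (a = a' ∧ b = b') := by rintro ⟨rfl, rfl⟩; exact h h'
      simp [this]
  · have h : (a, b) ∉ arcs π := fun h => absurd (mem_arcs.1 h).1 (not_lt.2 hab)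
    simp [elem_of_le hab, h]

/-- The linear map `x ↦ a x b` on strictly upper triangular matrices, for `a, b` invertible upper
triangular. -/
noncomputable def triAct (a b : upperTriangular K n) : strictUpper K n →ₗ[K] strictUpper K n where
  toFun x := ⟨(a.1 : Matrix (Fin n) (Fin n) K) * x.1 * (b.1 : Matrix (Fin n) (Fin n) K),
    mul_mem_strictUpper_right b.2 (mul_mem_strictUpper_left a.2 x.2)⟩
  map_add' x y := by ext; simp [mul_add, add_mul]
  map_smul' c x := by ext; simp

lemma triAct_comp (a b a' b' : upperTriangular K n) :
    triAct a b ∘ₗ triAct a' b' = triAct (a * a') (b' * b) := by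
  ext x : 2
  simp [triAct, mul_assoc]

lemma triAct_one : triAct (1 : upperTriangular K n) 1 = LinearMap.id := by
  ext x : 2
  simp [triAct]

lemma U_le_upperTriangular : U K n ≤ upperTriangular K n := fun _ h => h.1

lemma twoSided_eq_triAct (a b : U K n) :
    twoSided a b = triAct (Subgroup.inclusion U_le_upperTriangular a)
      (Subgroup.inclusion U_le_upperTriangular b) := rfl

lemma twoSided_comp (a b a' b' : U K n) :
    twoSided a b ∘ₗ twoSided a' b' = twoSided (a * a') (b' * b) := by
  simp [twoSided_eq_triAct, triAct_comp]

lemma twoSided_one : twoSided (1 : U K n) 1 = LinearMap.id := by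
  simp [twoSided_eq_triAct, triAct_one]

lemma mem_twoSidedOrbit_self (l : Module.Dual K (strictUpper K n)) : l ∈ twoSidedOrbit l :=
  ⟨1, 1, by simp [twoSided_one]⟩

lemma mem_twoSidedOrbit_trans {l l' l'' : Module.Dual K (strictUpper K n)}
    (h : l' ∈ twoSidedOrbit l) (h' : l'' ∈ twoSidedOrbit l') : l'' ∈ twoSidedOrbit l := by
  obtain ⟨a, b, rfl⟩ := h
  obtain ⟨a', b', rfl⟩ := h'
  exact ⟨a * a', b' * b, by rw [LinearMap.comp_assoc, twoSided_comp]⟩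

lemma mem_twoSidedOrbit_symm {l l' : Module.Dual K (strictUpper K n)}
    (h : l' ∈ twoSidedOrbit l) : l ∈ twoSidedOrbit l' := by
  obtain ⟨a, b, rfl⟩ := h
  exact ⟨a⁻¹, b⁻¹, by simp [LinearMap.comp_assoc, twoSided_comp, twoSided_one]⟩

/-- The elementary unitriangular matrix `1 + s E_{i,k}`, `i < k`. -/
noncomputable def elementaryU (i k : Fin n) (h : i < k) (s : K) : U K n :=
  ⟨⟨Matrix.transvection i k s, Matrix.transvection i k (-s),
    by rw [Matrix.transvection_mul_transvection_same i k h.ne]; simp,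
    by rw [Matrix.transvection_mul_transvection_same i k h.ne]; simp⟩, by
    constructor
    · intro a b hab
      have hab : b < a := hab
      have : ¬ (i = a ∧ k = b) := by rintro ⟨rfl, rfl⟩; exact absurd hab h.asymm
      simp [Matrix.transvection, this, Matrix.one_apply_ne hab.ne']
    · intro a
      have : ¬ (i = a ∧ k = a) := by rintro ⟨rfl, h'⟩; exact h.ne h'.symm
      simp [Matrix.transvection, this]⟩

/-- Precomposition with left multiplication by `1 + s E_{i,k}` is the row operation adding `s`
times the row `i` of a functional to its row `k`. -/
lemma comp_elementaryU_left (l : Module.Dual K (strictUpper K n)) {i k : Fin n} (h : i < k) (s : K)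
    (r c : Fin n) (hrc : r < c) : (l ∘ₗ twoSided (elementaryU i k h s) 1) (elem r c) =
      l (elem r c) + if r = k then s * l (elem i c) else 0 := by
  have : twoSided (elementaryU i k h s) 1 (elem r c) =
      elem r c + if r = k then s • elem i c else 0 := by
    apply Subtype.ext
    split_ifs with hr
    · subst hr
      simp [twoSided, elementaryU, Matrix.transvection, coe_elem hrc, coe_elem (h.trans hrc),
        add_mul]
    · simp [twoSided, elementaryU, Matrix.transvection, coe_elem hrc, add_mul,
        Matrix.single_mul_single_of_ne _ _ _ _ (Ne.symm hr)]
  rw [LinearMap.comp_apply, this]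
  split_ifs <;> simp

/-- Precomposition with right multiplication by `1 + s E_{i,k}` is the column operation adding `s`
times the column `k` of a functional to its column `i`. -/
lemma comp_elementaryU_right (l : Module.Dual K (strictUpper K n)) {i k : Fin n} (h : i < k) (s : K)
    (r c : Fin n) (hrc : r < c) : (l ∘ₗ twoSided 1 (elementaryU i k h s)) (elem r c) =
      l (elem r c) + if c = i then s * l (elem r k) else 0 := by
  have : twoSided 1 (elementaryU i k h s) (elem r c) =
      elem r c + if c = i then s • elem r k else 0 := by
    apply Subtype.ext
    split_ifs with hr
    · subst hr
      simp [twoSided, elementaryU, Matrix.transvection, coe_elem hrc, coe_elem (hrc.trans h),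
        mul_add]
    · simp [twoSided, elementaryU, Matrix.transvection, coe_elem hrc, mul_add,
        Matrix.single_mul_single_of_ne _ _ _ _ hr]
  rw [LinearMap.comp_apply, this]
  split_ifs <;> simp

/-- The rank of the position `(a, b)` when the columns are read from right to left and each column
from top to bottom. -/
def pos (p : Fin n × Fin n) : ℕ := finProdFinEquiv (p.2.rev, p.1)

lemma pos_injective : Function.Injective (pos : Fin n × Fin n → ℕ) := by
  rintro ⟨a, b⟩ ⟨a', b'⟩ h
  have := finProdFinEquiv.injective (Fin.ext h)
  simp only [Prod.mk.injEq, Fin.rev_inj] at this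
  exact Prod.ext this.2 this.1

lemma pos_lt_of_col {a b a' b' : Fin n} (h : b' < b) : pos (a, b) < pos (a', b') := by
  have h1 : (b.rev : ℕ) + 1 ≤ b'.rev := Nat.succ_le_of_lt (Fin.rev_lt_rev.2 h)
  have h2 := a.2
  simp only [pos, finProdFinEquiv_apply_val]
  nlinarith

lemma pos_lt_of_row {a a' b : Fin n} (h : a < a') : pos (a, b) < pos (a', b) := by
  simpa [pos] using h

lemma pos_lt_iff {a b a' b' : Fin n} :
    pos (a, b) < pos (a', b') ↔ b' < b ∨ (b = b' ∧ a < a') := by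
  constructor
  · intro h
    rcases lt_trichotomy b b' with hb | rfl | hb
    · exact absurd h (pos_lt_of_col hb).asymm
    · refine Or.inr ⟨rfl, ?_⟩
      rcases lt_trichotomy a a' with ha | rfl | ha
      · exact ha
      · exact absurd h (lt_irrefl _)
      · exact absurd h (pos_lt_of_row ha).asymm
    · exact Or.inl hb
  · rintro (h | ⟨rfl, h⟩)
    · exact pos_lt_of_col h
    · exact pos_lt_of_row h

/-- One step of the elimination: a nonzero entry sharing its row or column with an earlier nonzero
entry is cleared without affecting the earlier entries. -/
lemma exists_clear (l : Module.Dual K (strictUpper K n)) (k c : Fin n)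
    (hfree : ∀ a b a' b', pos (a, b) < pos (k, c) → pos (a', b') < pos (k, c) →
      l (elem a b) ≠ 0 → l (elem a' b') ≠ 0 → (a = a' ↔ b = b'))
    (hconf : ∃ a b, pos (a, b) < pos (k, c) ∧ l (elem a b) ≠ 0 ∧ (a = k ∨ b = c))
    (hkc : l (elem k c) ≠ 0) :
    ∃ l' ∈ twoSidedOrbit l, l' (elem k c) = 0 ∧
      ∀ a b, pos (a, b) < pos (k, c) → l' (elem a b) = l (elem a b) := by
  have hlt : ∀ {a b}, l (elem a b) ≠ 0 → a < b := fun {a b} h => by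
    by_contra hab
    exact h (by rw [elem_of_le (not_lt.1 hab), map_zero])
  obtain ⟨i, d, hpos, hid, hor⟩ := hconf
  have hkc' := hlt hkc
  by_cases hdc : d = c
  · subst hdc
    have hik : i < k := by simpa [pos_lt_iff] using hpos
    refine ⟨_, ⟨elementaryU i k hik (-(l (elem k d) / l (elem i d))), 1, rfl⟩, ?_, ?_⟩
    · rw [comp_elementaryU_left _ _ _ _ _ hkc']
      simp [hid]
    · intro a b hab
      rcases lt_or_ge a b with h | h
      · rw [comp_elementaryU_left _ _ _ _ _ h]
        split_ifs with hak
        · subst hak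
          have hdb : d < b := by simpa [pos_lt_iff] using hab
          have : l (elem i b) = 0 := by
            by_contra h0
            exact hdb.ne ((hfree i d i b hpos (pos_lt_of_col hdb) hid h0).1 rfl)
          simp [this]
        · simp
      · simp [elem_of_le h]
  · obtain rfl := hor.resolve_right hdc
    have hcd : c < d := by
      rcases pos_lt_iff.1 hpos with h | h
      · exact h
      · exact absurd h.1 hdc
    refine ⟨_, ⟨1, elementaryU c d hcd (-(l (elem i c) / l (elem i d))), rfl⟩, ?_, ?_⟩
    · rw [comp_elementaryU_right _ _ _ _ _ hkc']
      simp [hid]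
    · intro a b hab
      rcases lt_or_ge a b with h | h
      · rw [comp_elementaryU_right _ _ _ _ _ h]
        split_ifs with hbc
        · subst hbc
          have hai : a < i := by simpa [pos_lt_iff] using hab
          have : l (elem a d) = 0 := by
            by_contra h0
            exact hai.ne ((hfree a d i d (pos_lt_of_col hcd) hpos h0 hid).2 rfl)
          simp [this]
        · simp
      · simp [elem_of_le h]

/-- The elimination, up to the `m`-th position: the orbit contains a functional whose nonzero
entries among the first `m` positions lie in distinct rows and distinct columns. -/
lemma exists_conflictFree (l : Module.Dual K (strictUpper K n)) (m : ℕ) :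
    ∃ l' ∈ twoSidedOrbit l, ∀ a b a' b', pos (a, b) < m → pos (a', b') < m →
      l' (elem a b) ≠ 0 → l' (elem a' b') ≠ 0 → (a = a' ↔ b = b') := by
  induction m with
  | zero => exact ⟨l, mem_twoSidedOrbit_self l, fun a b a' b' h => absurd h (Nat.not_lt_zero _)⟩
  | succ m ih =>
    obtain ⟨l', hl', hfree⟩ := ih
    by_cases h : ∃ k c, pos (k, c) = m ∧ l' (elem k c) ≠ 0 ∧
        ∃ a b, pos (a, b) < pos (k, c) ∧ l' (elem a b) ≠ 0 ∧ (a = k ∨ b = c)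
    · obtain ⟨k, c, rfl, hkc, hconf⟩ := h
      obtain ⟨l'', hl'', h0, heq⟩ := exists_clear l' k c hfree hconf hkc
      refine ⟨l'', mem_twoSidedOrbit_trans hl' hl'', ?_⟩
      have hlt : ∀ {a b}, pos (a, b) < pos (k, c) + 1 → l'' (elem a b) ≠ 0 →
          pos (a, b) < pos (k, c) := by
        intro a b h hne
        refine (Nat.lt_succ_iff_lt_or_eq.1 h).resolve_right fun h => hne ?_
        have := pos_injective h
        simp only [Prod.mk.injEq] at this
        rw [this.1, this.2, h0]
      intro a b a' b' h h' hne hne'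
      have h1 := hlt h hne
      have h2 := hlt h' hne'
      rw [heq _ _ h1] at hne
      rw [heq _ _ h2] at hne'
      exact hfree a b a' b' h1 h2 hne hne'
    · push Not at h
      refine ⟨l', hl', ?_⟩
      have key : ∀ a b a' b', pos (a, b) < m → pos (a', b') = m → l' (elem a b) ≠ 0 →
          l' (elem a' b') ≠ 0 → (a = a' ↔ b = b') := by
        intro a b a' b' h1 h2 hne hne'
        have := h a' b' h2 hne' a b (h1.trans_eq h2.symm) hne
        exact iff_of_false this.1 this.2
      intro a b a' b' h1 h2 hne hne'
      rcases Nat.lt_succ_iff_lt_or_eq.1 h1 with h1 | h1 <;>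
        rcases Nat.lt_succ_iff_lt_or_eq.1 h2 with h2 | h2
      · exact hfree a b a' b' h1 h2 hne hne'
      · exact key a b a' b' h1 h2 hne hne'
      · simpa only [eq_comm] using key a' b' a b h2 h1 hne' hne
      · have := pos_injective (h1.trans h2.symm)
        simp only [Prod.mk.injEq] at this
        exact iff_of_true this.1 this.2

/-- Every functional lies in the two-sided orbit of the functional of a coloured set partition. -/
lemma exists_mem_twoSidedOrbit (l : Module.Dual K (strictUpper K n)) :
    ∃ (π : SetPartition n) (c : arcs π → Kˣ), l ∈ twoSidedOrbit (coloredFunctional π c) := by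
  classical
  obtain ⟨l', hl', hfree⟩ := exists_conflictFree l (n * n)
  have hfree : ∀ a b a' b', l' (elem a b) ≠ 0 → l' (elem a' b') ≠ 0 → (a = a' ↔ b = b') :=
    fun a b a' b' => hfree a b a' b' (Fin.is_lt _) (Fin.is_lt _)
  obtain ⟨π, hπ⟩ := exists_arcs_eq (n := n) {p | l' (elem p.1 p.2) ≠ 0}
    (fun a b h => by
      by_contra hab
      simp [elem_of_le (not_lt.1 hab)] at h)
    (fun a b b' h h' => (hfree a b a b' (by simpa using h) (by simpa using h')).1 rfl)
    (fun a a' b h h' => (hfree a b a' b (by simpa using h) (by simpa using h')).2 rfl)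
  have hmem : ∀ {p}, p ∈ arcs π ↔ l' (elem p.1 p.2) ≠ 0 := by simp [hπ]
  refine ⟨π, fun p => Units.mk0 (l' (elem p.1.1 p.1.2)) (hmem.1 p.2), ?_⟩
  suffices coloredFunctional π _ = l' by
    rw [this]
    exact mem_twoSidedOrbit_symm hl'
  refine dual_ext fun a b => ?_
  rw [coloredFunctional_elem]
  split_ifs with h
  · simp
  · exact (not_not.1 (mt hmem.2 h)).symm

end Functionals

/-! ### The shape of a functional -/

section Shape

variable {K : Type*} [Field K] {n : ℕ}

/-- The left kernel of the north-east corner (rows `< i`, columns `≥ j`) of a functional. -/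
def leftKer (i j : ℕ) (l : Module.Dual K (strictUpper K n)) : Set (Fin n → K) :=
  {v | (∀ a : Fin n, i ≤ a → v a = 0) ∧ ∀ w : Fin n → K, (∀ b : Fin n, (b : ℕ) < j → w b = 0) →
    l (strictUpperPart (Matrix.vecMulVec v w)) = 0}

/-- The rows `< i` of a set partition from which no arc leads to a column `≥ j`. -/
def freeRows (π : SetPartition n) (i j : ℕ) : Finset (Fin n) :=
  {a | (a : ℕ) < i ∧ ∀ b, (a, b) ∈ arcs π → (b : ℕ) < j}

lemma mem_freeRows {π : SetPartition n} {i j : ℕ} {a : Fin n} :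
    a ∈ freeRows π i j ↔ (a : ℕ) < i ∧ ∀ b, (a, b) ∈ arcs π → (b : ℕ) < j := by
  simp [freeRows]

lemma vecMulVec_mem_strictUpper {i j : ℕ} (hij : i ≤ j) {v w : Fin n → K}
    (hv : ∀ a : Fin n, i ≤ a → v a = 0) (hw : ∀ b : Fin n, (b : ℕ) < j → w b = 0) :
    Matrix.vecMulVec v w ∈ strictUpper K n := by
  intro r c hcr
  rw [Matrix.vecMulVec_apply]
  rcases lt_or_ge (r : ℕ) i with h | h
  · rw [hw c (lt_of_le_of_lt (Fin.le_def.1 hcr) (h.trans_le hij)), mul_zero]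
  · rw [hv r h, zero_mul]

lemma mulVec_mem_leftKer {i j : ℕ} (hij : i ≤ j) (l : Module.Dual K (strictUpper K n))
    (a b : upperTriangular K n) {v : Fin n → K} (hv : v ∈ leftKer i j (l ∘ₗ triAct a b)) :
    (a.1 : Matrix (Fin n) (Fin n) K).mulVec v ∈ leftKer i j l := by
  have hav : ∀ r : Fin n, i ≤ r → (a.1 : Matrix (Fin n) (Fin n) K).mulVec v r = 0 := by
    intro r hr
    rw [Matrix.mulVec, dotProduct]
    refine Finset.sum_eq_zero fun c _ => ?_
    rcases lt_or_ge c r with h | h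
    · rw [a.2 h, zero_mul]
    · rw [hv.1 c (hr.trans h), mul_zero]
  refine ⟨hav, fun w hw => ?_⟩
  have hw' : ∀ c : Fin n, (c : ℕ) < j →
      Matrix.vecMul w ((b⁻¹).1 : Matrix (Fin n) (Fin n) K) c = 0 := by
    intro c hc
    rw [Matrix.vecMul, dotProduct]
    refine Finset.sum_eq_zero fun r _ => ?_
    rcases lt_or_ge c r with h | h
    · rw [(b⁻¹).2 h, mul_zero]
    · rw [hw r (lt_of_le_of_lt (Fin.le_def.1 h) hc), zero_mul]
  have key := hv.2 _ hw'
  rw [LinearMap.comp_apply] at key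
  convert key using 2
  apply Subtype.ext
  rw [coe_strictUpperPart (vecMulVec_mem_strictUpper hij hav hw)]
  change _ = (a.1 : Matrix (Fin n) (Fin n) K) * _ * (b.1 : Matrix (Fin n) (Fin n) K)
  rw [coe_strictUpperPart (vecMulVec_mem_strictUpper hij hv.1 hw'), Matrix.mul_vecMulVec,
    Matrix.vecMulVec_mul, Matrix.vecMul_vecMul]
  simp

/-- The sizes of the left kernels of the corners are invariant under the two-sided action of the
invertible upper triangular matrices. -/
lemma ncard_leftKer_triAct [Finite K] {i j : ℕ} (hij : i ≤ j)
    (l : Module.Dual K (strictUpper K n)) (a b : upperTriangular K n) :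
    (leftKer i j (l ∘ₗ triAct a b)).ncard = (leftKer i j l).ncard := by
  have key : ∀ (l : Module.Dual K (strictUpper K n)) (a b : upperTriangular K n),
      (leftKer i j (l ∘ₗ triAct a b)).ncard ≤ (leftKer i j l).ncard := by
    intro l a b
    refine Set.ncard_le_ncard_of_injOn _ (fun v hv => mulVec_mem_leftKer hij l a b hv) ?_
      (Set.toFinite _)
    exact (Matrix.mulVec_injective_of_isUnit a.1.isUnit).injOn
  refine (key l a b).antisymm ?_
  have h : l = (l ∘ₗ triAct a b) ∘ₗ triAct a⁻¹ b⁻¹ := by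
    rw [LinearMap.comp_assoc, triAct_comp, mul_inv_cancel, inv_mul_cancel, triAct_one,
      LinearMap.comp_id]
  conv_lhs => rw [h]
  exact key _ _ _

lemma leftKer_coloredFunctional {i j : ℕ} (hij : i ≤ j) (π : SetPartition n) (c : arcs π → Kˣ) :
    leftKer i j (coloredFunctional π c) = {v | ∀ a, a ∉ freeRows π i j → v a = 0} := by
  ext v
  constructor
  · rintro ⟨hv, h⟩ a ha
    by_cases hai : i ≤ a
    · exact hv a hai
    · have ha : ∃ b, (a, b) ∈ arcs π ∧ j ≤ b := by
        simpa [mem_freeRows, not_le.1 hai] using ha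
      obtain ⟨b, hab, hb⟩ := ha
      have hw : ∀ b' : Fin n, (b' : ℕ) < j → (Pi.single b 1 : Fin n → K) b' = 0 := by
        intro b' hb'
        exact Pi.single_eq_of_ne (by rintro rfl; exact absurd hb (not_le.2 hb')) _
      have := h _ hw
      rw [coloredFunctional_apply, coe_strictUpperPart (vecMulVec_mem_strictUpper hij hv hw),
        Finset.sum_eq_single ⟨(a, b), hab⟩] at this
      · simpa [Matrix.vecMulVec_apply] using this
      · rintro ⟨⟨a', b'⟩, h'⟩ _ hne
        have hb' : b' ≠ b := by
          rintro rfl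
          obtain rfl := arcs_left_unique h' hab
          exact hne rfl
        simp [Matrix.vecMulVec_apply, Pi.single_eq_of_ne hb']
      · simp
  · intro h
    have hv : ∀ a : Fin n, i ≤ a → v a = 0 := fun a ha =>
      h a fun h' => absurd (mem_freeRows.1 h').1 (not_lt.2 ha)
    refine ⟨hv, fun w hw => ?_⟩
    rw [coloredFunctional_apply, coe_strictUpperPart (vecMulVec_mem_strictUpper hij hv hw)]
    refine Finset.sum_eq_zero ?_
    rintro ⟨⟨a, b⟩, hab⟩ _
    simp only [Matrix.vecMulVec_apply]
    by_cases ha : a ∈ freeRows π i j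
    · rw [hw b ((mem_freeRows.1 ha).2 b hab)]
      simp
    · rw [h a ha]
      simp

lemma ncard_setOf_supported [Fintype K] (S : Finset (Fin n)) :
    {v : Fin n → K | ∀ a, a ∉ S → v a = 0}.ncard = Fintype.card K ^ S.card := by
  classical
  have : {v : Fin n → K | ∀ a, a ∉ S → v a = 0} =
      (Fintype.piFinset fun a => if a ∈ S then Finset.univ else {0} : Finset (Fin n → K)) := by
    ext v
    simp only [Set.mem_ofPred_eq, Finset.mem_coe, Fintype.mem_piFinset]
    refine forall_congr' fun a => ?_
    split_ifs with h <;> simp [h]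
  rw [this, Set.ncard_coe_finset, Fintype.card_piFinset]
  simp [apply_ite Finset.card]

lemma ncard_leftKer_coloredFunctional [Fintype K] {i j : ℕ} (hij : i ≤ j) (π : SetPartition n)
    (c : arcs π → Kˣ) :
    (leftKer i j (coloredFunctional π c)).ncard = Fintype.card K ^ (freeRows π i j).card := by
  rw [leftKer_coloredFunctional hij, ncard_setOf_supported]

/-- The sizes of the sets `freeRows` determine a set partition. -/
lemma eq_of_card_freeRows {π π' : SetPartition n}
    (h : ∀ i j, i ≤ j → (freeRows π i j).card = (freeRows π' i j).card) : π = π' := by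
  classical
  have hcard : ∀ (π : SetPartition n) (a : Fin n) (j : ℕ), (freeRows π (a + 1) j).card =
      (freeRows π a j).card + if ∀ b, (a, b) ∈ arcs π → (b : ℕ) < j then 1 else 0 := by
    intro π a j
    split_ifs with hb
    · rw [← Finset.card_insert_of_notMem (a := a) (by simp [mem_freeRows])]
      congr 1
      ext r
      simp only [Finset.mem_insert, mem_freeRows, Nat.lt_succ_iff_lt_or_eq, ← Fin.ext_iff]
      constructor
      · rintro ⟨h | h, h'⟩
        · exact Or.inr ⟨h, h'⟩
        · exact Or.inl h
      · rintro (rfl | ⟨h, h'⟩)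
        · exact ⟨Or.inr rfl, hb⟩
        · exact ⟨Or.inl h, h'⟩
    · rw [add_zero]
      congr 1
      ext r
      simp only [mem_freeRows, Nat.lt_succ_iff_lt_or_eq, ← Fin.ext_iff]
      constructor
      · rintro ⟨h | rfl, h'⟩
        · exact ⟨h, h'⟩
        · exact absurd h' hb
      · rintro ⟨h, h'⟩
        exact ⟨Or.inl h, h'⟩
  have hiff : ∀ (a : Fin n) (j : ℕ), (a : ℕ) < j →
      ((∀ b, (a, b) ∈ arcs π → (b : ℕ) < j) ↔ ∀ b, (a, b) ∈ arcs π' → (b : ℕ) < j) := by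
    intro a j haj
    have h1 := h (a + 1) j haj
    rw [hcard, hcard, h a j haj.le] at h1
    have := Nat.add_left_cancel h1
    split_ifs at this with hp hp' hp'
    · exact iff_of_true hp hp'
    · exact iff_of_false hp hp'
  have hmem : ∀ (π : SetPartition n) (a b : Fin n), (a, b) ∈ arcs π ↔
      a < b ∧ (¬ ∀ b', (a, b') ∈ arcs π → (b' : ℕ) < b) ∧
        ∀ b', (a, b') ∈ arcs π → (b' : ℕ) < b + 1 := by
    intro π a b
    constructor
    · intro hab
      refine ⟨(mem_arcs.1 hab).1, fun h => absurd (h b hab) (lt_irrefl _), fun b' hb' => ?_⟩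
      rw [arcs_right_unique hb' hab]
      exact Nat.lt_succ_self _
    · rintro ⟨_, h1, h2⟩
      push Not at h1
      obtain ⟨b', hb', hle⟩ := h1
      have : b' = b := Fin.ext (le_antisymm (Nat.lt_succ_iff.1 (h2 b' hb')) hle)
      exact this ▸ hb'
  refine arcs_injective (Finset.ext ?_)
  rintro ⟨a, b⟩
  rw [hmem π, hmem π']
  refine and_congr_right fun hab => ?_
  rw [hiff a b hab, hiff a (b + 1) (Nat.lt_succ_of_lt hab)]

/-- The shape of a functional: the set partition `π` such that the functional lies in the orbit of
a functional `λ_{π,c}`. -/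
noncomputable def shape (l : Module.Dual K (strictUpper K n)) : SetPartition n :=
  (exists_mem_twoSidedOrbit l).choose

lemma ncard_leftKer_of_mem [Fintype K] {i j : ℕ} (hij : i ≤ j)
    {l : Module.Dual K (strictUpper K n)} {π : SetPartition n} {c : arcs π → Kˣ}
    (h : l ∈ twoSidedOrbit (coloredFunctional π c)) :
    (leftKer i j l).ncard = Fintype.card K ^ (freeRows π i j).card := by
  obtain ⟨a, b, rfl⟩ := h
  rw [twoSided_eq_triAct, ncard_leftKer_triAct hij, ncard_leftKer_coloredFunctional hij]

lemma ncard_leftKer [Fintype K] {i j : ℕ} (hij : i ≤ j) (l : Module.Dual K (strictUpper K n)) :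
    (leftKer i j l).ncard = Fintype.card K ^ (freeRows (shape l) i j).card :=
  ncard_leftKer_of_mem hij (exists_mem_twoSidedOrbit l).choose_spec.choose_spec

lemma shape_eq_of_ncard_leftKer [Fintype K] {l : Module.Dual K (strictUpper K n)}
    {π : SetPartition n}
    (h : ∀ i j, i ≤ j → (leftKer i j l).ncard = Fintype.card K ^ (freeRows π i j).card) :
    shape l = π := by
  refine eq_of_card_freeRows fun i j hij => ?_
  have := h i j hij
  rw [ncard_leftKer hij] at this
  exact Nat.pow_right_injective Fintype.one_lt_card this

lemma shape_eq_iff [Finite K] {l : Module.Dual K (strictUpper K n)} {π : SetPartition n} :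
    shape l = π ↔ ∃ c : arcs π → Kˣ, l ∈ twoSidedOrbit (coloredFunctional π c) := by
  have := Fintype.ofFinite K
  constructor
  · rintro rfl
    exact (exists_mem_twoSidedOrbit l).choose_spec
  · rintro ⟨c, hc⟩
    exact shape_eq_of_ncard_leftKer fun i j hij => ncard_leftKer_of_mem hij hc

lemma shape_coloredFunctional [Finite K] (π : SetPartition n) (c : arcs π → Kˣ) :
    shape (coloredFunctional π c) = π :=
  shape_eq_iff.2 ⟨c, mem_twoSidedOrbit_self _⟩

lemma shape_comp_triAct [Finite K] (l : Module.Dual K (strictUpper K n))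
    (a b : upperTriangular K n) : shape (l ∘ₗ triAct a b) = shape l := by
  have := Fintype.ofFinite K
  exact shape_eq_of_ncard_leftKer fun i j hij => by
    rw [ncard_leftKer_triAct hij, ncard_leftKer hij]

end Shape

/-! ### Supercharacters as sums over the functionals of a given shape -/

section Characters

variable {K : Type*} [Field K] {n : ℕ}

lemma subOne_bijective : Function.Bijective (subOne : U K n → strictUpper K n) := by
  constructor
  · intro u v h
    have h : (u.1 : Matrix (Fin n) (Fin n) K) - 1 = (v.1 : Matrix (Fin n) (Fin n) K) - 1 :=
      congrArg Subtype.val h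
    exact Subtype.ext (Units.ext (sub_left_injective h))
  · intro x
    have htri : (1 + x.1).BlockTriangular id := by
      intro i j hij
      have hij : j < i := hij
      simp [x.2 i j hij.le, Matrix.one_apply_ne hij.ne']
    have hdet : (1 + x.1).det = 1 := by
      rw [Matrix.det_of_isUpperTriangular htri]
      exact Finset.prod_eq_one fun i _ => by simp [x.2 i i le_rfl]
    refine ⟨⟨Matrix.GeneralLinearGroup.mkOfDetNeZero (1 + x.1) (by rw [hdet]; exact one_ne_zero),
      htri, fun i => ?_⟩, ?_⟩
    · change (1 + x.1) i i = 1
      simp [x.2 i i le_rfl]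
    · apply Subtype.ext
      change (1 + x.1) - 1 = x.1
      simp

lemma subOne_one : subOne (1 : U K n) = 0 := by
  apply Subtype.ext
  simp [subOne]

instance [Finite K] : Finite (Module.Dual K (strictUpper K n)) :=
  DFunLike.finite _

noncomputable instance [Finite K] : Fintype (Module.Dual K (strictUpper K n)) :=
  Fintype.ofFinite _

variable (K n) in
lemma card_dual_eq_card_U [Fintype K] :
    Fintype.card (Module.Dual K (strictUpper K n)) = Fintype.card (U K n) := by
  rw [← Nat.card_eq_fintype_card, ← Nat.card_eq_fintype_card,
    Nat.card_eq_of_bijective _ (subOne_bijective (K := K) (n := n)),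
    Module.natCard_eq_pow_finrank (K := K) (V := Module.Dual K (strictUpper K n)),
    Module.natCard_eq_pow_finrank (K := K) (V := strictUpper K n), Subspace.dual_finrank_eq]

open scoped Classical in
/-- The functionals of shape `π`, i.e. the union of the two-sided orbits of the functionals
`λ_{π,c}`. -/
noncomputable def shapeClass (K : Type*) [Field K] [Finite K] {n : ℕ} (π : SetPartition n) :
    Finset (Module.Dual K (strictUpper K n)) :=
  {l | shape l = π}

lemma mem_shapeClass [Finite K] {π : SetPartition n} {l : Module.Dual K (strictUpper K n)} :
    l ∈ shapeClass K π ↔ shape l = π := by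
  simp [shapeClass]

lemma card_shapeClass_pos (K : Type*) [Field K] [Finite K] (π : SetPartition n) :
    0 < (shapeClass K π).card :=
  Finset.card_pos.2 ⟨_, mem_shapeClass.2 (shape_coloredFunctional π 1)⟩

open scoped Classical in
lemma sum_theta_dual [Fintype K] (θ : AddChar K ℂ) (hθ : θ ≠ 1)
    (l : Module.Dual K (strictUpper K n)) :
    ∑ u : U K n, θ (l (subOne u)) = if l = 0 then (Fintype.card (U K n) : ℂ) else 0 := by
  split_ifs with h
  · simp [h]
  · have : Fintype (strictUpper K n) := Fintype.ofFinite _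
    rw [subOne_bijective.sum_comp (fun x => θ (l x))]
    have hne : θ.compAddMonoidHom l.toAddMonoidHom ≠ 1 := by
      obtain ⟨k, hk⟩ := AddChar.ne_one_iff.1 hθ
      obtain ⟨x, rfl⟩ := LinearMap.surjective h k
      exact AddChar.ne_one_iff.2 ⟨x, hk⟩
    exact AddChar.sum_eq_zero_iff_ne_zero.2 hne

open scoped Classical in
/-- Orthonormality of the characters `u ↦ θ (l (u - 1))` of the additive group, in summed form. -/
lemma classInner_sum_theta [Fintype K] (θ : AddChar K ℂ) (hθ : θ ≠ 1) {ι : Type*}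
    (S : Finset (Module.Dual K (strictUpper K n))) (T : Finset ι)
    (r : ι → Module.Dual K (strictUpper K n)) :
    classInner (fun u : U K n => ∑ l ∈ S, θ (l (subOne u)))
      (fun u => ∑ i ∈ T, θ (r i (subOne u))) = ((T.filter fun i => r i ∈ S).card : ℂ) := by
  have h1 : ∀ u : U K n, (starRingEnd ℂ) (∑ l ∈ S, θ (l (subOne u))) *
      ∑ i ∈ T, θ (r i (subOne u)) = ∑ i ∈ T, ∑ l ∈ S, θ ((r i - l) (subOne u)) := by
    intro u
    rw [map_sum, Finset.sum_mul_sum, Finset.sum_comm]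
    refine Finset.sum_congr rfl fun i _ => Finset.sum_congr rfl fun l _ => ?_
    rw [← AddChar.map_neg_eq_conj, ← AddChar.map_add_eq_mul]
    congr 1
    rw [LinearMap.sub_apply]
    ring
  have h2 : ∀ i, (∑ l ∈ S, if r i - l = 0 then (Fintype.card (U K n) : ℂ) else 0) =
      if r i ∈ S then (Fintype.card (U K n) : ℂ) else 0 := by
    intro i
    simp only [sub_eq_zero]
    exact Finset.sum_ite_eq S (r i) _
  have h3 : ∀ i, ∑ u : U K n, ∑ l ∈ S, θ ((r i - l) (subOne u)) =
      if r i ∈ S then (Fintype.card (U K n) : ℂ) else 0 := by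
    intro i
    rw [Finset.sum_comm, ← h2 i]
    exact Finset.sum_congr rfl fun l _ => sum_theta_dual θ hθ _
  rw [classInner, Finset.sum_congr rfl fun u _ => h1 u, Finset.sum_comm,
    Finset.sum_congr rfl fun i _ => h3 i, Finset.sum_ite, Finset.sum_const_zero, add_zero,
    Finset.sum_const, nsmul_eq_mul,
    mul_left_comm, inv_mul_cancel₀ (by simp), mul_one]

/-- The diagonal matrix with given invertible entries, as an invertible upper triangular matrix. -/
noncomputable def diagonalTri (t : Fin n → Kˣ) : upperTriangular K n :=
  ⟨⟨Matrix.diagonal fun i => (t i : K), Matrix.diagonal fun i => ((t i)⁻¹ : Kˣ),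
    by simp [Matrix.diagonal_mul_diagonal], by simp [Matrix.diagonal_mul_diagonal]⟩,
    Matrix.blockTriangular_diagonal _⟩

/-- As every row contains at most one arc, scaling the rows changes the colouring arbitrarily. -/
lemma exists_diagonal_coloredFunctional (π : SetPartition n) (c : arcs π → Kˣ) :
    ∃ d : upperTriangular K n, ∀ c' : arcs π → Kˣ,
      coloredFunctional π c' ∘ₗ triAct d 1 = coloredFunctional π (c * c') := by
  classical
  let t : Fin n → Kˣ := fun a =>
    if h : ∃ b, (a, b) ∈ arcs π then c ⟨(a, h.choose), h.choose_spec⟩ else 1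
  have ht : ∀ p : arcs π, t p.1.1 = c p := by
    rintro ⟨⟨a, b⟩, h⟩
    have h' : ∃ b, (a, b) ∈ arcs π := ⟨b, h⟩
    simp only [t, h', dif_pos]
    congr
    exact arcs_right_unique h'.choose_spec h
  refine ⟨diagonalTri t, fun c' => ?_⟩
  ext x
  rw [LinearMap.comp_apply, coloredFunctional_apply, coloredFunctional_apply]
  refine Finset.sum_congr rfl fun p _ => ?_
  simp [triAct, diagonalTri, ht, mul_left_comm, mul_assoc]

lemma conj_mem_U (d : upperTriangular K n) (a : U K n) : d.1 * a.1 * d.1⁻¹ ∈ U K n := by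
  refine ⟨mul_mem (mul_mem d.2 (U_le_upperTriangular a.2)) (inv_mem d.2), fun i => ?_⟩
  have h1 := mul_diag (K := K) d.2 (inv_mem d.2 : d.1⁻¹ ∈ upperTriangular K n) i
  rw [← Units.val_mul, mul_inv_cancel, Units.val_one, Matrix.one_apply_eq] at h1
  rw [Units.val_mul, mul_diag (mul_mem d.2 (U_le_upperTriangular a.2) : d.1 * a.1 ∈ _)
    (inv_mem d.2 : d.1⁻¹ ∈ upperTriangular K n), Units.val_mul, mul_diag d.2 a.2.1, a.2.2, mul_one,
    ← h1]

lemma comp_triAct_injective (d e : upperTriangular K n) :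
    Function.Injective fun l : Module.Dual K (strictUpper K n) => l ∘ₗ triAct d e := by
  intro l l' h
  have := congrArg (fun m => m ∘ₗ triAct d⁻¹ e⁻¹) h
  simpa [LinearMap.comp_assoc, triAct_comp, triAct_one] using this

lemma mem_twoSidedOrbit_comp_triAct (d : upperTriangular K n)
    {l m : Module.Dual K (strictUpper K n)} (h : m ∈ twoSidedOrbit l) :
    m ∘ₗ triAct d 1 ∈ twoSidedOrbit (l ∘ₗ triAct d 1) := by
  obtain ⟨a, b, rfl⟩ := h
  refine ⟨⟨_, by simpa using conj_mem_U d⁻¹ a⟩, b, ?_⟩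
  rw [twoSided_eq_triAct, twoSided_eq_triAct, LinearMap.comp_assoc, LinearMap.comp_assoc,
    triAct_comp, triAct_comp]
  congr 2
  · apply Subtype.ext
    simp [mul_assoc]
  · simp

lemma comp_triAct_mem_twoSidedOrbit_iff (d : upperTriangular K n)
    {l m : Module.Dual K (strictUpper K n)} :
    m ∘ₗ triAct d 1 ∈ twoSidedOrbit (l ∘ₗ triAct d 1) ↔ m ∈ twoSidedOrbit l := by
  refine ⟨fun h => ?_, mem_twoSidedOrbit_comp_triAct d⟩
  have := mem_twoSidedOrbit_comp_triAct d⁻¹ h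
  simpa [LinearMap.comp_assoc, triAct_comp, triAct_one] using this

lemma twoSidedOrbit_comp_triAct (d : upperTriangular K n) (l : Module.Dual K (strictUpper K n)) :
    twoSidedOrbit (l ∘ₗ triAct d 1) = (fun m => m ∘ₗ triAct d 1) '' twoSidedOrbit l := by
  ext m
  constructor
  · intro h
    have hm : m = (m ∘ₗ triAct d⁻¹ 1) ∘ₗ triAct d 1 := by
      simp [LinearMap.comp_assoc, triAct_comp, triAct_one]
    rw [hm] at h ⊢
    exact ⟨_, (comp_triAct_mem_twoSidedOrbit_iff d).1 h, rfl⟩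
  · rintro ⟨m, hm, rfl⟩
    exact mem_twoSidedOrbit_comp_triAct d hm

lemma oneSidedOrbit_comp_triAct (d : upperTriangular K n) (l : Module.Dual K (strictUpper K n)) :
    oneSidedOrbit (l ∘ₗ triAct d 1) = (fun m => m ∘ₗ triAct d 1) '' oneSidedOrbit l := by
  have key : ∀ b : U K n,
      (l ∘ₗ triAct d 1) ∘ₗ twoSided 1 b = (l ∘ₗ twoSided 1 b) ∘ₗ triAct d 1 := by
    intro b
    rw [twoSided_eq_triAct, LinearMap.comp_assoc, LinearMap.comp_assoc, triAct_comp, triAct_comp]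
    simp
  ext m
  constructor
  · rintro ⟨b, rfl⟩
    exact ⟨_, ⟨b, rfl⟩, (key b).symm⟩
  · rintro ⟨_, ⟨b, rfl⟩, rfl⟩
    exact ⟨b, (key b).symm⟩

open scoped Classical in
/-- The coefficient of `u ↦ θ (l (u - 1))` in the supercharacter `χ^π`. -/
noncomputable def charCoeff [Fintype K] (π : SetPartition n) (l : Module.Dual K (strictUpper K n)) :
    ℝ :=
  ∑ c : arcs π → Kˣ, if l ∈ twoSidedOrbit (coloredFunctional π c) then
    ((oneSidedOrbit (coloredFunctional π c)).ncard : ℝ) /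
      ((twoSidedOrbit (coloredFunctional π c)).ncard : ℝ) else 0

lemma supercharacter_eq_sum_charCoeff [Fintype K] (θ : AddChar K ℂ) (π : SetPartition n)
    (u : U K n) : supercharacter θ π u =
      ∑ l : Module.Dual K (strictUpper K n), (charCoeff π l : ℂ) * θ (l (subOne u)) := by
  classical
  simp only [supercharacter, coloredSupercharacter, charCoeff]
  push_cast
  simp_rw [Finset.sum_mul]
  rw [Finset.sum_comm]
  refine Finset.sum_congr rfl fun c _ => ?_
  rw [finsum_mem_eq_finite_toFinset_sum _ (Set.toFinite _), Finset.mul_sum,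
    ← Finset.sum_filter_add_sum_filter_not Finset.univ
      (fun l => l ∈ twoSidedOrbit (coloredFunctional π c)) (fun l => (_ : ℂ) * θ (l (subOne u)))]
  rw [Finset.sum_eq_zero (s := Finset.filter (fun l => ¬ _) _), add_zero]
  · refine Finset.sum_congr (by ext; simp) fun l hl => ?_
    have hl : l ∈ twoSidedOrbit (coloredFunctional π c) := by simpa using hl
    simp [hl]
  · intro l hl
    have hl : l ∉ twoSidedOrbit (coloredFunctional π c) := by simpa using hl
    simp [hl]

/-- The common value of `charCoeff π` on the functionals of shape `π`. -/
noncomputable def shapeCoeff (K : Type*) [Field K] [Fintype K] {n : ℕ} (π : SetPartition n) : ℝ :=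
  charCoeff π (coloredFunctional π (1 : arcs π → Kˣ))

lemma shapeCoeff_pos (K : Type*) [Field K] [Fintype K] (π : SetPartition n) :
    0 < shapeCoeff K π := by
  classical
  have hne : ∀ c : arcs π → Kˣ, 0 < (oneSidedOrbit (coloredFunctional π c)).ncard ∧
      0 < (twoSidedOrbit (coloredFunctional π c)).ncard := fun c =>
    ⟨(Set.ncard_pos (Set.toFinite _)).2 ⟨_, 1, by rw [twoSided_one]⟩,
      (Set.ncard_pos (Set.toFinite _)).2 ⟨_, mem_twoSidedOrbit_self _⟩⟩
  refine Finset.sum_pos' (fun c _ => ?_) ⟨1, Finset.mem_univ _, ?_⟩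
  · split_ifs
    · positivity
    · exact le_rfl
  · rw [if_pos (mem_twoSidedOrbit_self _)]
    have := hne 1
    exact div_pos (by exact_mod_cast this.1) (by exact_mod_cast this.2)

/-- Scaling the rows of functionals permutes the summands of `χ^π`, and is transitive on the
colourings; hence the coefficients of `χ^π` are constant on the functionals of shape `π`. -/
lemma charCoeff_coloredFunctional [Fintype K] (π : SetPartition n) (c : arcs π → Kˣ) :
    charCoeff π (coloredFunctional π c) = shapeCoeff K π := by
  classical
  obtain ⟨d, hd⟩ := exists_diagonal_coloredFunctional π c
  rw [shapeCoeff, charCoeff, charCoeff, ← Equiv.sum_comp (Equiv.mulLeft c)]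
  refine Finset.sum_congr rfl fun c' _ => ?_
  have h1 : coloredFunctional π c = coloredFunctional π 1 ∘ₗ triAct d 1 := by
    rw [hd, mul_one]
  rw [Equiv.coe_mulLeft, ← hd c', h1, oneSidedOrbit_comp_triAct]
  simp only [comp_triAct_mem_twoSidedOrbit_iff]
  rw [twoSidedOrbit_comp_triAct, Set.ncard_image_of_injective _ (comp_triAct_injective d 1),
    Set.ncard_image_of_injective _ (comp_triAct_injective d 1)]

open scoped Classical in
lemma charCoeff_eq [Fintype K] (π : SetPartition n) (l : Module.Dual K (strictUpper K n)) :
    charCoeff π l = if l ∈ shapeClass K π then shapeCoeff K π else 0 := by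
  split_ifs with h
  · obtain ⟨c, hc⟩ := shape_eq_iff.1 (mem_shapeClass.1 h)
    rw [← charCoeff_coloredFunctional π c, charCoeff, charCoeff]
    refine Finset.sum_congr rfl fun c' _ => ?_
    have : l ∈ twoSidedOrbit (coloredFunctional π c') ↔
        coloredFunctional π c ∈ twoSidedOrbit (coloredFunctional π c') :=
      ⟨fun h => mem_twoSidedOrbit_trans h (mem_twoSidedOrbit_symm hc),
        fun h => mem_twoSidedOrbit_trans h hc⟩
    simp only [this]
  · refine Finset.sum_eq_zero fun c _ => if_neg fun hc => h ?_
    exact mem_shapeClass.2 (shape_eq_iff.2 ⟨c, hc⟩)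

lemma supercharacter_eq [Fintype K] (θ : AddChar K ℂ) (π : SetPartition n) (u : U K n) :
    supercharacter θ π u =
      shapeCoeff K π * ∑ l ∈ shapeClass K π, θ (l (subOne u)) := by
  classical
  rw [supercharacter_eq_sum_charCoeff, Finset.mul_sum,
    ← Finset.sum_filter_add_sum_filter_not Finset.univ (fun l => l ∈ shapeClass K π)]
  rw [Finset.sum_eq_zero (s := Finset.filter (fun l => ¬ _) _), add_zero]
  · refine Finset.sum_congr (by ext; simp) fun l hl => ?_
    rw [charCoeff_eq, if_pos hl]
  · intro l hl
    rw [charCoeff_eq, if_neg (by simpa using hl)]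
    simp

lemma supercharacter_one [Fintype K] (θ : AddChar K ℂ) (π : SetPartition n) :
    supercharacter θ π 1 = shapeCoeff K π * (shapeClass K π).card := by
  simp [supercharacter_eq, subOne_one]

lemma classInner_const_mul {G : Type*} [Group G] [Fintype G] (r s : ℝ) (φ ψ : G → ℂ) :
    classInner (fun g => (r : ℂ) * φ g) (fun g => (s : ℂ) * ψ g) = r * s * classInner φ ψ := by
  simp only [classInner, map_mul, Complex.conj_ofReal, Finset.mul_sum]
  exact Finset.sum_congr rfl fun g _ => by ring

lemma classInner_supercharacter_self [Fintype K] (θ : AddChar K ℂ) (hθ : θ ≠ 1)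
    (π : SetPartition n) : classInner (supercharacter θ π) (supercharacter θ π) =
      (shapeCoeff K π : ℂ) * shapeCoeff K π * (shapeClass K π).card := by
  classical
  have h : supercharacter θ π = fun u => (shapeCoeff K π : ℂ) *
      ∑ l ∈ shapeClass K π, θ (l (subOne u)) := funext (supercharacter_eq θ π)
  rw [h, classInner_const_mul, classInner_sum_theta θ hθ _ _ fun l => l]
  simp

/-- The superplancherel measure is the law of the shape of a uniform random functional. -/
lemma SPl_eq [Fintype K] (θ : AddChar K ℂ) (hθ : θ ≠ 1) (π : SetPartition n) :
    SPl θ π = (shapeClass K π).card / Fintype.card (Module.Dual K (strictUpper K n)) := by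
  have h1 : (shapeCoeff K π : ℂ) ≠ 0 := by exact_mod_cast (shapeCoeff_pos K π).ne'
  have h2 : ((shapeClass K π).card : ℂ) ≠ 0 := by exact_mod_cast (card_shapeClass_pos K π).ne'
  rw [SPl, superPlancherelWeight, supercharacter_one, classInner_supercharacter_self θ hθ,
    card_dual_eq_card_U]
  have h3 : (Fintype.card (U K n) : ℂ) ≠ 0 := by simp
  field_simp

end Characters

/-! ### Superinduction and the Bratteli diagram -/

section Frobenius

variable {H G : Type*} [Group H] [Fintype H] [Group G] [Fintype G]

/-- Frobenius reciprocity: superinduction is adjoint to restriction of superclass functions. -/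
lemma classInner_superInd (scl : Setoid G) (ι : H →* G) (hι : Function.Injective ι)
    (φ : H → ℂ) (ψ : G → ℂ) (hψ : ∀ g h, scl g h → ψ g = ψ h) :
    classInner (superInd scl ι φ) ψ = classInner φ (fun h => ψ (ι h)) := by
  classical
  let c : G → ℂ := fun g => (({k | scl g k} : Set G).ncard : ℂ)
  have hc : ∀ g k, scl g k → c g = c k := by
    intro g k h
    have : ({x | scl g x} : Set G) = {x | scl k x} := by
      ext x
      exact ⟨fun hx => scl.trans (scl.symm h) hx, fun hx => scl.trans h hx⟩
    simp only [c, this]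
  have hc0 : ∀ g, c g ≠ 0 := by
    intro g
    have : 0 < ({k | scl g k} : Set G).ncard :=
      (Set.ncard_pos (Set.toFinite _)).2 ⟨g, scl.refl g⟩
    exact Nat.cast_ne_zero.2 this.ne'
  have hcsum : ∀ k, ∑ g, (if scl g k then (1 : ℂ) else 0) = c k := by
    intro k
    rw [Finset.sum_boole]
    simp only [c]
    congr 1
    rw [Set.ncard_eq_toFinset_card']
    congr 1
    ext g
    simp [scl.comm' (x := g) (y := k)]
  have hG : (Fintype.card G : ℂ) ≠ 0 := by simp
  have h1 : ∀ g, (starRingEnd ℂ) (superInd scl ι φ g) * ψ g =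
      ∑ k, (Fintype.card G : ℂ) / Fintype.card H *
        ((starRingEnd ℂ) (Function.extend ι φ 0 k) * ψ k / c k) * if scl g k then 1 else 0 := by
    intro g
    rw [superInd, finsum_mem_eq_finite_toFinset_sum _ (Set.toFinite _)]
    simp only [map_mul, map_div₀, map_natCast, map_sum, mul_ite, mul_one, mul_zero]
    rw [← Finset.sum_filter, Finset.mul_sum, Finset.sum_mul]
    refine Finset.sum_congr (by ext; simp) fun k hk => ?_
    have hk : scl g k := by simpa using hk
    rw [hψ g k hk, ← hc g k hk]
    have := hc0 g
    simp only [c] at this ⊢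
    field_simp
  have h2 : ∑ h, (starRingEnd ℂ) (φ h) * ψ (ι h) =
      ∑ k, (starRingEnd ℂ) (Function.extend ι φ 0 k) * ψ k := by
    refine Fintype.sum_of_injective ι hι _ _ (fun k hk => ?_) fun h => ?_
    · rw [Function.extend_apply' _ _ _ hk]
      simp
    · rw [hι.extend_apply]
  rw [classInner, classInner, h2, Finset.sum_congr rfl fun g _ => h1 g, Finset.sum_comm,
    Finset.mul_sum, Finset.mul_sum]
  refine Finset.sum_congr rfl fun k _ => ?_
  rw [← Finset.mul_sum, hcsum]
  have := hc0 k
  field_simp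

end Frobenius

section Bratteli

variable {K : Type*} [Field K] {n : ℕ}

variable (K n) in
/-- The embedding `x ↦ diag(x, 0)` of strictly upper triangular matrices. -/
def extendZero : strictUpper K n →ₗ[K] strictUpper K (n + 1) where
  toFun x := ⟨Matrix.reindex finSumFinEquiv finSumFinEquiv
    (Matrix.fromBlocks x.1 0 0 (0 : Matrix (Fin 1) (Fin 1) K)), by
      intro i j hij
      induction i using Fin.addCases <;> induction j using Fin.addCases
      · simpa using x.2 _ _ (Fin.le_def.2 hij)
      all_goals simp⟩
  map_add' x y := by
    apply Subtype.ext
    ext i j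
    induction i using Fin.addCases <;> induction j using Fin.addCases <;> simp
  map_smul' r x := by
    apply Subtype.ext
    ext i j
    induction i using Fin.addCases <;> induction j using Fin.addCases <;> simp

lemma extendZero_injective : Function.Injective (extendZero K n) := by
  intro x y h
  ext i j
  have := congrFun (congrFun (congrArg Subtype.val h) (Fin.castAdd 1 i)) (Fin.castAdd 1 j)
  simpa [extendZero] using this

lemma subOne_embed (u : U K n) : subOne (embed K n u) = extendZero K n (subOne u) := by
  apply Subtype.ext
  change Matrix.reindex finSumFinEquiv finSumFinEquiv
    (Matrix.fromBlocks u.1.1 0 0 (1 : Matrix (Fin 1) (Fin 1) K)) - 1 =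
    Matrix.reindex finSumFinEquiv finSumFinEquiv
    (Matrix.fromBlocks (u.1.1 - 1) 0 0 (0 : Matrix (Fin 1) (Fin 1) K))
  ext i j
  induction i using Fin.addCases <;> induction j using Fin.addCases <;>
    simp [Matrix.one_apply, Fin.ext_iff]
  all_goals omega

lemma embed_injective : Function.Injective (embed K n) := by
  intro u v h
  apply subOne_bijective.1
  apply extendZero_injective
  rw [← subOne_embed, ← subOne_embed, h]

/-- The supercharacters are constant on superclasses. -/
lemma supercharacter_eq_of_superclass [Fintype K] (θ : AddChar K ℂ) (π : SetPartition n)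
    (g h : U K n) (hgh : superclass K n g h) : supercharacter θ π g = supercharacter θ π h := by
  obtain ⟨a, ha, b, hb, e⟩ := hgh
  have he : subOne h = triAct ⟨a, ha⟩ ⟨b, hb⟩ (subOne g) := Subtype.ext e
  rw [supercharacter_eq, supercharacter_eq, he]
  congr 1
  symm
  refine Finset.sum_nbij' (fun l => l ∘ₗ triAct ⟨a, ha⟩ ⟨b, hb⟩)
    (fun l => l ∘ₗ triAct (⟨a, ha⟩ : upperTriangular K n)⁻¹ (⟨b, hb⟩ : upperTriangular K n)⁻¹)
    ?_ ?_ ?_ ?_ ?_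
  · intro l hl
    rw [mem_shapeClass] at hl ⊢
    rw [shape_comp_triAct, hl]
  · intro l hl
    rw [mem_shapeClass] at hl ⊢
    rw [shape_comp_triAct, hl]
  · intro l _
    rw [LinearMap.comp_assoc, triAct_comp, mul_inv_cancel, inv_mul_cancel, triAct_one,
      LinearMap.comp_id]
  · intro l _
    rw [LinearMap.comp_assoc, triAct_comp, mul_inv_cancel, inv_mul_cancel, triAct_one,
      LinearMap.comp_id]
  · intro l _
    rfl

open scoped Classical in
/-- The number of functionals of shape `L` whose restriction to the leading `n × n` block has
shape `l`. -/
noncomputable def edgeCount (K : Type*) [Field K] [Finite K] {n : ℕ} (l : SetPartition n)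
    (L : SetPartition (n + 1)) : ℕ :=
  ((shapeClass K L).filter fun m => (extendZero K n).dualMap m ∈ shapeClass K l).card

lemma multiplicity_eq [Fintype K] (θ : AddChar K ℂ) (hθ : θ ≠ 1) (l : SetPartition n)
    (L : SetPartition (n + 1)) : multiplicity θ l L =
      shapeCoeff K L * edgeCount K l L / (shapeCoeff K l * (shapeClass K l).card) := by
  classical
  have h1 : (shapeCoeff K l : ℂ) ≠ 0 := by exact_mod_cast (shapeCoeff_pos K l).ne'
  have h2 : ((shapeClass K l).card : ℂ) ≠ 0 := by exact_mod_cast (card_shapeClass_pos K l).ne'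
  have hl : supercharacter θ l = fun u => (shapeCoeff K l : ℂ) *
      ∑ m ∈ shapeClass K l, θ (m (subOne u)) := funext (supercharacter_eq θ l)
  have hL : (fun u => supercharacter θ L (embed K n u)) = fun u => (shapeCoeff K L : ℂ) *
      ∑ m ∈ shapeClass K L, θ ((extendZero K n).dualMap m (subOne u)) := by
    funext u
    rw [supercharacter_eq, subOne_embed]
    rfl
  rw [multiplicity, classInner_superInd _ _ embed_injective _ _
    (supercharacter_eq_of_superclass θ L), classInner_supercharacter_self θ hθ, hL, hl,
    classInner_const_mul, classInner_sum_theta θ hθ, edgeCount]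
  field_simp
  congr!

lemma sum_edgeCount_left [Finite K] (L : SetPartition (n + 1)) :
    ∑ l : SetPartition n, edgeCount K l L = (shapeClass K L).card := by
  classical
  rw [Finset.card_eq_sum_card_fiberwise (f := fun m => shape ((extendZero K n).dualMap m))
    (t := Finset.univ) (fun _ _ => Finset.mem_coe.2 (Finset.mem_univ _))]
  refine Finset.sum_congr rfl fun l _ => ?_
  simp only [edgeCount, mem_shapeClass]

open scoped Classical in
/-- All fibres of a surjective homomorphism of finite groups have the same size. -/
lemma card_filter_mul_card {A B : Type*} [AddCommGroup A] [Fintype A] [AddCommGroup B] [Fintype B]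
    (f : A →+ B) (hf : Function.Surjective f) (S : Finset B) :
    (Finset.univ.filter fun a => f a ∈ S).card * Fintype.card B = S.card * Fintype.card A := by
  have h : ∀ b, (Finset.univ.filter fun a => f a = b).card =
      (Finset.univ.filter fun a => f a = 0).card := fun b =>
    AddMonoidHom.card_fiber_eq_of_mem_range f (hf b) (hf 0)
  have h1 : ∀ S : Finset B, (Finset.univ.filter fun a => f a ∈ S).card =
      S.card * (Finset.univ.filter fun a => f a = 0).card := by
    intro S
    rw [Finset.card_eq_sum_card_fiberwise (f := f) (t := S) (fun a ha => by simpa using ha),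
      ← smul_eq_mul, ← Finset.sum_const]
    refine Finset.sum_congr rfl fun b hb => ?_
    rw [← h b, Finset.filter_filter]
    congr 1
    ext a
    simp only [Finset.mem_filter, Finset.mem_univ, true_and]
    exact ⟨fun h => h.2, fun h => ⟨h ▸ hb, h⟩⟩
  have h2 := h1 Finset.univ
  simp only [Finset.mem_univ, Finset.filter_true, Finset.card_univ] at h2
  rw [h1, h2]
  ring

lemma sum_edgeCount_right [Finite K] (l : SetPartition n) :
    (∑ L : SetPartition (n + 1), edgeCount K l L) *
        Fintype.card (Module.Dual K (strictUpper K n)) =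
      (shapeClass K l).card * Fintype.card (Module.Dual K (strictUpper K (n + 1))) := by
  classical
  rw [← card_filter_mul_card (extendZero K n).dualMap.toAddMonoidHom
    (LinearMap.dualMap_surjective_of_injective extendZero_injective)]
  congr 1
  rw [Finset.card_eq_sum_card_fiberwise (f := shape) (t := Finset.univ)
    (fun _ _ => Finset.mem_coe.2 (Finset.mem_univ _))]
  refine Finset.sum_congr rfl fun L _ => ?_
  rw [edgeCount, Finset.filter_filter]
  congr 1
  ext m
  simp [mem_shapeClass, and_comm]

instance : Subsingleton (SetPartition 0) :=
  ⟨fun _ _ => arcs_injective (Finset.ext fun p => p.1.elim0)⟩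

/-- Up to a factor which does not depend on the vertex, the dimension of a vertex is the degree of
its supercharacter. -/
lemma exists_bratteliDim_eq [Fintype K] (θ : AddChar K ℂ) (hθ : θ ≠ 1) :
    ∃ r : ℂ, r ≠ 0 ∧ ∀ (n : ℕ) (L : SetPartition n),
      bratteliDim θ n L = r * (shapeCoeff K L * (shapeClass K L).card) := by
  have hne : ∀ (n : ℕ) (L : SetPartition n),
      (shapeCoeff K L * (shapeClass K L).card : ℂ) ≠ 0 := fun n L =>
    mul_ne_zero (by exact_mod_cast (shapeCoeff_pos K L).ne')
      (by exact_mod_cast (card_shapeClass_pos K L).ne')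
  -- The constant is fixed by the normalisation `dim ∅ = 1` at the root.
  let o : SetPartition 0 := ⊥
  refine ⟨(shapeCoeff K o * (shapeClass K o).card : ℂ)⁻¹, inv_ne_zero (hne 0 o), fun n => ?_⟩
  induction n with
  | zero =>
    intro L
    rw [Subsingleton.elim L o, inv_mul_cancel₀ (hne 0 o), bratteliDim]
  | succ n ih =>
    intro L
    have h : ∀ l : SetPartition n, bratteliDim θ n l * multiplicity θ l L =
        (shapeCoeff K o * (shapeClass K o).card : ℂ)⁻¹ * shapeCoeff K L * edgeCount K l L := by
      intro l
      rw [ih, multiplicity_eq θ hθ, mul_assoc, mul_div_cancel₀ _ (hne n l), mul_assoc]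
    rw [bratteliDim, Finset.sum_congr rfl fun l _ => h l, ← Finset.mul_sum, ← Nat.cast_sum,
      sum_edgeCount_left, mul_assoc]

/-- The conditional probability that a uniform random functional in dimension `n + 1` has shape
`L`, given that its restriction to dimension `n` has shape `l`. -/
noncomputable def transProb (K : Type*) [Field K] [Finite K] {n : ℕ} (l : SetPartition n)
    (L : SetPartition (n + 1)) : ℝ :=
  edgeCount K l L * Fintype.card (Module.Dual K (strictUpper K n)) /
    ((shapeClass K l).card * Fintype.card (Module.Dual K (strictUpper K (n + 1))))

lemma transition_eq [Fintype K] (θ : AddChar K ℂ) (hθ : θ ≠ 1) (l : SetPartition n)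
    (L : SetPartition (n + 1)) : transition θ l L = (transProb K l L : ℂ) := by
  obtain ⟨r, hr, hdim⟩ := exists_bratteliDim_eq θ hθ
  have h1 : (shapeCoeff K l : ℂ) ≠ 0 := by exact_mod_cast (shapeCoeff_pos K l).ne'
  have h2 : ((shapeClass K l).card : ℂ) ≠ 0 := by exact_mod_cast (card_shapeClass_pos K l).ne'
  have h3 : (shapeCoeff K L : ℂ) ≠ 0 := by exact_mod_cast (shapeCoeff_pos K L).ne'
  have h4 : ((shapeClass K L).card : ℂ) ≠ 0 := by exact_mod_cast (card_shapeClass_pos K L).ne'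
  have h5 : (Fintype.card (Module.Dual K (strictUpper K n)) : ℂ) ≠ 0 := by simp
  have h6 : (Fintype.card (Module.Dual K (strictUpper K (n + 1))) : ℂ) ≠ 0 := by simp
  rw [transition, hdim, hdim, SPl_eq θ hθ, SPl_eq θ hθ, multiplicity_eq θ hθ, transProb]
  push_cast
  field_simp

lemma transProb_nonneg [Finite K] (l : SetPartition n) (L : SetPartition (n + 1)) :
    0 ≤ transProb K l L := by
  unfold transProb
  positivity

lemma sum_transProb [Finite K] (l : SetPartition n) :
    ∑ L : SetPartition (n + 1), transProb K l L = 1 := by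
  have h2 : ((shapeClass K l).card : ℝ) ≠ 0 := by exact_mod_cast (card_shapeClass_pos K l).ne'
  have h6 : (Fintype.card (Module.Dual K (strictUpper K (n + 1))) : ℝ) ≠ 0 := by simp
  simp only [transProb]
  rw [← Finset.sum_div, ← Finset.sum_mul, div_eq_one_iff_eq (mul_ne_zero h2 h6)]
  exact_mod_cast sum_edgeCount_right (K := K) l

/-- The superplancherel measure as a real number. -/
noncomputable def realSPl (K : Type*) [Field K] [Finite K] {n : ℕ} (π : SetPartition n) : ℝ :=
  (shapeClass K π).card / Fintype.card (Module.Dual K (strictUpper K n))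

lemma SPl_eq_realSPl [Fintype K] (θ : AddChar K ℂ) (hθ : θ ≠ 1) (π : SetPartition n) :
    SPl θ π = (realSPl K π : ℂ) := by
  rw [SPl_eq θ hθ, realSPl]
  push_cast
  rfl

/-- The superplancherel measures are coherent for the transition probabilities. -/
lemma sum_realSPl_mul_transProb [Finite K] (L : SetPartition (n + 1)) :
    ∑ l : SetPartition n, realSPl K l * transProb K l L = realSPl K L := by
  have h : ∀ l : SetPartition n, realSPl K l * transProb K l L =
      edgeCount K l L / Fintype.card (Module.Dual K (strictUpper K (n + 1))) := by
    intro l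
    have h2 : ((shapeClass K l).card : ℝ) ≠ 0 := by exact_mod_cast (card_shapeClass_pos K l).ne'
    have h5 : (Fintype.card (Module.Dual K (strictUpper K n)) : ℝ) ≠ 0 := by simp
    rw [realSPl, transProb]
    field_simp
  rw [Finset.sum_congr rfl fun l _ => h l, ← Finset.sum_div, ← Nat.cast_sum, sum_edgeCount_left,
    realSPl]

lemma realSPl_zero [Finite K] (π : SetPartition 0) : realSPl K π = 1 := by
  have h : shapeClass K π = Finset.univ := by
    ext l
    simp only [mem_shapeClass, Finset.mem_univ, iff_true]
    exact Subsingleton.elim _ _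
  rw [realSPl, h, Finset.card_univ, div_self (by simp)]

lemma transProb_eq_zero_of_not_isEdge [Fintype K] (θ : AddChar K ℂ) (hθ : θ ≠ 1)
    {l : SetPartition n} {L : SetPartition (n + 1)} (h : ¬ IsEdge θ l L) : transProb K l L = 0 := by
  have h0 : multiplicity θ l L = 0 := not_not.1 h
  have := transition_eq θ hθ l L
  rw [transition, h0, mul_zero, zero_div] at this
  exact_mod_cast this.symm

end Bratteli

/-! ### The Markov chain of shapes -/

section MarkovChain

open ProbabilityTheory Preorder

variable {X : ℕ → Type*}

lemma frestrictLe_preimage_singleton (N : ℕ) (l : ∀ n, X n) :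
    frestrictLe N ⁻¹' {frestrictLe N l} = {w : ∀ n, X n | ∀ i ≤ N, w i = l i} := by
  ext w
  simp only [Set.mem_preimage, Set.mem_singleton_iff, funext_iff]
  exact ⟨fun h i hi => h ⟨i, Finset.mem_Iic.2 hi⟩, fun h i => h i (Finset.mem_Iic.1 i.2)⟩

lemma exists_frestrictLe_eq [∀ n, Inhabited (X n)] (N : ℕ) (x : (i : Finset.Iic N) → X i) :
    ∃ l : ∀ n, X n, frestrictLe N l = x := by
  refine ⟨fun i => if h : i ∈ Finset.Iic N then x ⟨i, h⟩ else default, ?_⟩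
  funext i
  exact dif_pos i.2

variable [∀ n, MeasurableSpace (X n)] [∀ n, Countable (X n)] [∀ n, DiscreteMeasurableSpace (X n)]

/-- Finite measures on sequences of discrete variables are determined by the cylinders. -/
lemma measure_eq_of_cylinders [∀ n, Inhabited (X n)] {P Q : Measure (∀ n, X n)}
    [IsFiniteMeasure P] [IsFiniteMeasure Q]
    (h : ∀ N (l : ∀ n, X n), P {w | ∀ i ≤ N, w i = l i} = Q {w | ∀ i ≤ N, w i = l i}) : P = Q := by
  have hproj := isProjectiveMeasureFamily_map_restrict (P := Q) (X := fun n (w : ∀ n, X n) => w n)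
    fun t => (measurable_pi_apply t).aemeasurable
  have hQ : IsProjectiveLimit Q fun I => Q.map fun w => I.restrict fun n => w n := fun I => rfl
  have hP : IsProjectiveLimit P fun I => Q.map fun w => I.restrict fun n => w n := by
    rw [isProjectiveLimit_nat_iff hproj]
    intro N
    rw [Measure.ext_iff_singleton]
    intro x
    obtain ⟨l, rfl⟩ := exists_frestrictLe_eq N x
    rw [Measure.map_apply (measurable_frestrictLe N) (measurableSet_singleton _),
      frestrictLe_preimage_singleton, h, ← frestrictLe_preimage_singleton,
      ← Measure.map_apply (measurable_frestrictLe N) (measurableSet_singleton _)]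
    rfl
  exact hP.unique hQ

/-- Existence of Markov chains with prescribed transition probabilities on finite state spaces. -/
lemma exists_markovChain [∀ n, Fintype (X n)] [∀ n, Inhabited (X n)] [Subsingleton (X 0)]
    (p : ∀ n, X n → X (n + 1) → ℝ) (hp : ∀ n x y, 0 ≤ p n x y) (hsum : ∀ n x, ∑ y, p n x y = 1) :
    ∃ Q : Measure (∀ n, X n), IsProbabilityMeasure Q ∧ ∀ N (l : ∀ n, X n),
      Q {w | ∀ i ≤ N, w i = l i} =
        ENNReal.ofReal (∏ i ∈ Finset.range N, p i (l i) (l (i + 1))) := by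
  let law : ∀ n, X n → PMF (X (n + 1)) := fun n x =>
    PMF.ofFintype (fun y => ENNReal.ofReal (p n x y)) (by
      rw [← ENNReal.ofReal_sum_of_nonneg fun y _ => hp n x y, hsum, ENNReal.ofReal_one])
  let κ : ∀ n, Kernel ((i : Finset.Iic n) → X i) (X (n + 1)) := fun n =>
    Kernel.ofFunOfCountable fun x => (law n (x ⟨n, Finset.mem_Iic.2 le_rfl⟩)).toMeasure
  have hκ : ∀ n, IsMarkovKernel (κ n) := fun n => ⟨fun x => PMF.toMeasure.isProbabilityMeasure _⟩
  let Q := Kernel.trajMeasure (Measure.dirac (default : X 0)) κ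
  refine ⟨Q, inferInstance, fun N l => ?_⟩
  induction N with
  | zero =>
    have : {w : ∀ n, X n | ∀ i ≤ 0, w i = l i} = Set.univ := by
      ext w
      simpa using Subsingleton.elim _ _
    rw [this]
    simp
  | succ N ih =>
    have h1 : {w : ∀ n, X n | ∀ i ≤ N + 1, w i = l i} =
        (fun w => (frestrictLe N w, w (N + 1))) ⁻¹' ({frestrictLe N l} ×ˢ {l (N + 1)}) := by
      ext w
      have := Set.ext_iff.1 (frestrictLe_preimage_singleton N l) w
      simp only [Set.mem_preimage, Set.mem_singleton_iff] at this
      simp only [Set.mem_preimage, Set.mem_prod, Set.mem_singleton_iff, this, Set.mem_ofPred_eq]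
      constructor
      · exact fun h => ⟨fun i hi => h i (hi.trans (Nat.le_succ _)), h _ le_rfl⟩
      · rintro ⟨h, h'⟩ i hi
        rcases Nat.le_succ_iff.1 hi with hi | rfl
        · exact h i hi
        · exact h'
    rw [h1, ← Measure.map_apply (by fun_prop)
      ((measurableSet_singleton _).prod (measurableSet_singleton _)),
      ← Kernel.map_frestrictLe_trajMeasure_compProd_eq_map_trajMeasure,
      Measure.compProd_apply_prod (measurableSet_singleton _) (measurableSet_singleton _),
      lintegral_singleton, Measure.map_apply (by fun_prop) (measurableSet_singleton _),
      frestrictLe_preimage_singleton, ih, Finset.prod_range_succ, mul_comm,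
      ENNReal.ofReal_mul (Finset.prod_nonneg fun i _ => hp _ _ _)]
    congr 1
    change (law N (l N)).toMeasure {l (N + 1)} = _
    rw [PMF.toMeasure_apply_singleton _ _ (measurableSet_singleton _)]
    rfl

end MarkovChain

section PathMeasure

open Preorder

variable {K : Type*} [Field K] [Fintype K] (θ : AddChar K ℂ)

instance (n : ℕ) : DiscreteMeasurableSpace (SetPartition n) := ⟨fun _ => trivial⟩

instance (n : ℕ) : Inhabited (SetPartition n) := ⟨⊥⟩

lemma measurableSet_paths :
    MeasurableSet {w : ∀ n, SetPartition n | ∀ n, IsEdge θ (w n) (w (n + 1))} := by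
  have : {w : ∀ n, SetPartition n | ∀ n, IsEdge θ (w n) (w (n + 1))} =
      ⋂ n, (fun w : ∀ n, SetPartition n => (w n, w (n + 1))) ⁻¹' {p | IsEdge θ p.1 p.2} := by
    ext w
    simp
  rw [this]
  exact MeasurableSet.iInter fun n => (by fun_prop : Measurable _) (MeasurableSet.of_discrete)


lemma measurableEmbedding_path :
    MeasurableEmbedding (Subtype.val : InfinitePath θ → ∀ n, SetPartition n) :=
  MeasurableEmbedding.subtype_coe (measurableSet_paths θ)

lemma isPathMeasure_iff (hθ : θ ≠ 1) (P : Measure (InfinitePath θ)) :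
    IsPathMeasure θ P ↔ IsProbabilityMeasure P ∧ ∀ N (l : ∀ n, SetPartition n),
      P.real {w | ∀ i ≤ N, w.1 i = l i} =
        ∏ i ∈ Finset.range N, transProb K (l i) (l (i + 1)) := by
  refine and_congr_right fun _ => forall₂_congr fun N l => ?_
  rw [Finset.prod_congr rfl fun i _ => transition_eq θ hθ (l i) (l (i + 1)), ← Complex.ofReal_prod,
    Complex.ofReal_inj]

lemma IsPathMeasure.unique (hθ : θ ≠ 1) {P Q : Measure (InfinitePath θ)} (hP : IsPathMeasure θ P)
    (hQ : IsPathMeasure θ Q) : P = Q := by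
  rw [isPathMeasure_iff θ hθ] at hP hQ
  have := hP.1
  have := hQ.1
  have hemb := measurableEmbedding_path θ
  rw [← hemb.comap_map P, ← hemb.comap_map Q]
  congr 1
  refine measure_eq_of_cylinders fun N l => ?_
  rw [hemb.map_apply, hemb.map_apply, ← ENNReal.toReal_eq_toReal_iff' (measure_ne_top _ _)
    (measure_ne_top _ _)]
  exact (hP.2 N l).trans (hQ.2 N l).symm

lemma exists_isPathMeasure (hθ : θ ≠ 1) : ∃ P : Measure (InfinitePath θ), IsPathMeasure θ P := by
  obtain ⟨Q, hQ, hcyl⟩ := exists_markovChain (fun n => transProb K (n := n))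
    (fun n => transProb_nonneg) (fun n => sum_transProb)
  -- Almost every trajectory of the chain follows the edges of the diagram.
  have hpath : ∀ᵐ w ∂Q, ∀ n, IsEdge θ (w n) (w (n + 1)) := by
    rw [ae_all_iff]
    intro n
    rw [ae_iff]
    refine measure_mono_null (t := ⋃ x : (i : Finset.Iic (n + 1)) → SetPartition i,
      {w | ¬ IsEdge θ (w n) (w (n + 1)) ∧ frestrictLe (n + 1) w = x})
      (fun w hw => Set.mem_iUnion.2 ⟨_, hw, rfl⟩) (measure_iUnion_null fun x => ?_)
    obtain ⟨l, rfl⟩ := exists_frestrictLe_eq (n + 1) x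
    by_cases hl : IsEdge θ (l n) (l (n + 1))
    · convert measure_empty (μ := Q)
      refine Set.eq_empty_of_forall_notMem fun w hw => hw.1 ?_
      have h : ∀ i ≤ n + 1, w i = l i := by
        have : w ∈ frestrictLe (n + 1) ⁻¹' {frestrictLe (n + 1) l} := hw.2
        rwa [frestrictLe_preimage_singleton] at this
      rwa [h n (Nat.le_succ n), h (n + 1) le_rfl]
    · refine measure_mono_null (t := frestrictLe (n + 1) ⁻¹' {frestrictLe (n + 1) l})
        (fun w hw => hw.2) ?_
      rw [frestrictLe_preimage_singleton, hcyl, Finset.prod_range_succ,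
        transProb_eq_zero_of_not_isEdge θ hθ hl, mul_zero, ENNReal.ofReal_zero]
  have hval : ∀ s : Set (∀ n, SetPartition n),
      Q.comap (Subtype.val : InfinitePath θ → _) (Subtype.val ⁻¹' s) = Q s := by
    intro s
    rw [(measurableEmbedding_path θ).comap_apply]
    refine measure_congr ?_
    filter_upwards [hpath] with w hw
    refine propext ⟨?_, fun h => ⟨⟨w, hw⟩, h, rfl⟩⟩
    rintro ⟨w', h, rfl⟩
    exact h
  refine ⟨Q.comap Subtype.val, (isPathMeasure_iff θ hθ _).2 ⟨⟨?_⟩, fun N l => ?_⟩⟩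
  · have := hval Set.univ
    rwa [Set.preimage_univ, measure_univ (μ := Q)] at this
  · have := hval {w | ∀ i ≤ N, w i = l i}
    rw [hcyl] at this
    change (Q.comap _ _).toReal = _
    erw [this]
    exact ENNReal.toReal_ofReal (Finset.prod_nonneg fun i _ => transProb_nonneg _ _)

/-- The coordinates of the path measure have the superplancherel laws. -/
lemma IsPathMeasure.measureReal_coord (hθ : θ ≠ 1) {P : Measure (InfinitePath θ)}
    (hP : IsPathMeasure θ P) (n : ℕ) (π : SetPartition n) :
    P.real {w | w.1 n = π} = realSPl K π := by
  classical
  obtain ⟨_, hcyl⟩ := (isPathMeasure_iff θ hθ P).1 hP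
  induction n with
  | zero =>
    have : {w : InfinitePath θ | w.1 0 = π} = Set.univ := by
      ext w
      simpa using Subsingleton.elim _ _
    rw [this, realSPl_zero]
    simp
  | succ n ih =>
    let f : InfinitePath θ → (i : Finset.Iic n) → SetPartition i := fun w => frestrictLe n w.1
    let e : Finset.Iic n := ⟨n, Finset.mem_Iic.2 le_rfl⟩
    have hf : Measurable f := by fun_prop
    have hstep : ∀ x, (P.restrict {w | w.1 (n + 1) = π}).real (f ⁻¹' {x}) =
        P.real (f ⁻¹' {x}) * transProb K (x e) π := by
      intro x
      obtain ⟨l, rfl⟩ := exists_frestrictLe_eq n x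
      let l' : ∀ n, SetPartition n := Function.update l (n + 1) π
      have hl' : ∀ i ≤ n, l' i = l i := fun i hi =>
        Function.update_of_ne (by omega) _ _
      have hl'' : l' (n + 1) = π := Function.update_self _ _ _
      have h1 := hcyl (n + 1) l'
      have h2 := hcyl n l
      rw [Finset.prod_range_succ, hl'' , hl' n le_rfl,
        Finset.prod_congr rfl fun i hi => by
          rw [hl' i (Finset.mem_range.1 hi).le, hl' (i + 1) (Finset.mem_range.1 hi)], ← h2] at h1
      rw [measureReal_restrict_apply (hf (measurableSet_singleton _))]
      have h3 : f ⁻¹' {frestrictLe n l} = {w | ∀ i ≤ n, w.1 i = l i} :=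
        congrArg (fun s => (Subtype.val : InfinitePath θ → _) ⁻¹' s)
          (frestrictLe_preimage_singleton n l)
      rw [h3]
      refine Eq.trans (congrArg P.real ?_) h1
      ext w
      constructor
      · rintro ⟨h, h'⟩ i hi
        rcases Nat.le_succ_iff.1 hi with hi | rfl
        · rw [h i hi, hl' i hi]
        · exact h'.trans hl''.symm
      · exact fun h => ⟨fun i hi => (h i (hi.trans (Nat.le_succ n))).trans (hl' i hi),
          (h _ le_rfl).trans hl''⟩
    have hfib : ∀ l : SetPartition n, ∑ x with x e = l, P.real (f ⁻¹' {x}) = realSPl K l := by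
      intro l
      rw [sum_measureReal_preimage_singleton _ fun x _ => hf (measurableSet_singleton x), ← ih l]
      congr 1
      ext w
      simp [f, e]
    have htot : P.real {w | w.1 (n + 1) = π} =
        ∑ x, (P.restrict {w | w.1 (n + 1) = π}).real (f ⁻¹' {x}) := by
      rw [sum_measureReal_preimage_singleton _ fun x _ => hf (measurableSet_singleton x)]
      simp
    rw [htot, Finset.sum_congr rfl fun x _ => hstep x, ← sum_realSPl_mul_transProb,
      ← Finset.sum_fiberwise Finset.univ (fun x => x e)]
    refine Finset.sum_congr rfl fun l _ => ?_
    rw [← hfib l, Finset.sum_mul]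
    refine Finset.sum_congr rfl fun x hx => ?_
    rw [(Finset.mem_filter.1 hx).2]

end PathMeasure

/-! ### Corners of a random functional have almost full rank -/

section Random

variable {K : Type*} [Field K] {n : ℕ}

/-- The values of a functional on the matrices `v wᵀ`, as a function of the coordinates `≥ j`
of `w`. -/
noncomputable def cornerForm (j : ℕ) (v : Fin n → K) :
    Module.Dual K (strictUpper K n) →+ ({b : Fin n // j ≤ b} → K) where
  toFun l b := l (strictUpperPart (Matrix.vecMulVec v (Pi.single b.1 1)))
  map_zero' := rfl
  map_add' _ _ := rfl

lemma single_eq_zero_of_lt {j : ℕ} (b : {b : Fin n // j ≤ b}) (b' : Fin n) (hb' : (b' : ℕ) < j) :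
    (Pi.single b.1 1 : Fin n → K) b' = 0 :=
  Pi.single_eq_of_ne (by rintro rfl; exact absurd b.2 (not_le.2 hb')) _

lemma cornerForm_surjective {i j : ℕ} (hij : i ≤ j) {v : Fin n → K} (hv0 : v ≠ 0)
    (hv : ∀ a : Fin n, i ≤ a → v a = 0) : Function.Surjective (cornerForm (K := K) j v) := by
  obtain ⟨a, ha⟩ := Function.ne_iff.1 hv0
  have ha : v a ≠ 0 := ha
  intro g
  let l : Module.Dual K (strictUpper K n) :=
    { toFun := fun x => ∑ b : {b : Fin n // j ≤ b}, g b / v a * x.1 a b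
      map_add' := fun x y => by simp [mul_add, Finset.sum_add_distrib]
      map_smul' := fun r x => by simp [Finset.mul_sum, mul_left_comm] }
  refine ⟨l, funext fun b => ?_⟩
  change ∑ b' : {b : Fin n // j ≤ b}, g b' / v a *
    (strictUpperPart (Matrix.vecMulVec v (Pi.single b.1 1))).1 a b' = g b
  rw [coe_strictUpperPart (vecMulVec_mem_strictUpper hij hv (single_eq_zero_of_lt b)),
    Finset.sum_eq_single b]
  · simp [Matrix.vecMulVec_apply, ha]
  · intro b' _ hne
    have : (b' : Fin n) ≠ b := fun h => hne (Subtype.ext h)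
    simp [Matrix.vecMulVec_apply, Pi.single_eq_of_ne this]
  · simp

lemma card_subtype_ge {i : ℕ} (hi : i ≤ n) : Fintype.card {b : Fin n // n - i ≤ b} = i := by
  have := Fintype.card_subtype_compl fun b : Fin n => (b : ℕ) < n - i
  simp only [not_lt, Fintype.card_fin] at this
  rw [this, Fintype.card_subtype, Fin.card_filter_val_lt]
  omega

open scoped Classical in
/-- The first moment bound: a north-east corner with `i` rows and `i` columns of a random
functional has on average at most two vectors in its left kernel. -/
lemma sum_ncard_leftKer_le [Fintype K] {i : ℕ} (hi : 2 * i ≤ n) :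
    ∑ l : Module.Dual K (strictUpper K n), (leftKer i (n - i) l).ncard ≤
      2 * Fintype.card (Module.Dual K (strictUpper K n)) := by
  set D := Fintype.card (Module.Dual K (strictUpper K n)) with hD
  set q := Fintype.card K with hq
  have hq0 : 0 < q ^ i := pow_pos Fintype.card_pos i
  have hij : i ≤ n - i := by omega
  have h1 : ∀ l : Module.Dual K (strictUpper K n), (leftKer i (n - i) l).ncard =
      ∑ v : Fin n → K, if v ∈ leftKer i (n - i) l then 1 else 0 := by
    intro l
    rw [Finset.sum_boole, Set.ncard_eq_toFinset_card', Nat.cast_id]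
    congr 1
    ext v
    simp
  have h2 : ∀ v : Fin n → K,
      (∑ l : Module.Dual K (strictUpper K n), if v ∈ leftKer i (n - i) l then 1 else 0) * q ^ i ≤
      (if v = 0 then D * q ^ i else 0) +
        if v ∈ {v : Fin n → K | ∀ a : Fin n, i ≤ a → v a = 0} then D else 0 := by
    intro v
    by_cases hv0 : v = 0
    · rw [if_pos hv0]
      refine le_add_right (Nat.mul_le_mul_right _ ?_)
      rw [Finset.sum_boole, Nat.cast_id]
      exact Finset.card_filter_le _ _
    · rw [if_neg hv0, zero_add]
      split_ifs with hv
      · have := card_filter_mul_card (cornerForm (K := K) (n - i) v)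
          (cornerForm_surjective hij hv0 hv) {0}
        rw [Finset.card_singleton, one_mul, Fintype.card_fun, card_subtype_ge (by omega)] at this
        rw [hD, ← this, Finset.sum_boole, Nat.cast_id]
        refine Nat.mul_le_mul_right _ (Finset.card_le_card fun l hl => ?_)
        simp only [Finset.mem_filter, Finset.mem_univ, true_and, Finset.mem_singleton] at hl ⊢
        exact funext fun b => hl.2 _ (single_eq_zero_of_lt b)
      · rw [Finset.sum_eq_zero fun l _ => if_neg fun h => hv h.1, zero_mul]
  have h3 : (∑ v : Fin n → K,
      if v ∈ {v : Fin n → K | ∀ a : Fin n, i ≤ a → v a = 0} then D else 0) = q ^ i * D := by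
    have := ncard_setOf_supported (K := K) (Finset.univ.filter fun a : Fin n => (a : ℕ) < i)
    rw [Fin.card_filter_val_lt, min_eq_right (by omega)] at this
    simp only [Finset.mem_filter, Finset.mem_univ, true_and, not_lt] at this
    rw [← Finset.sum_filter, Finset.sum_const, smul_eq_mul, hq, ← this,
      Set.ncard_eq_toFinset_card']
    congr 2
    ext v
    simp
  refine Nat.le_of_mul_le_mul_right (c := q ^ i) ?_ hq0
  rw [Finset.sum_congr rfl fun l _ => h1 l, Finset.sum_comm, Finset.sum_mul]
  refine (Finset.sum_le_sum fun v _ => h2 v).trans ?_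
  rw [Finset.sum_add_distrib, h3, Finset.sum_ite_eq' Finset.univ (0 : Fin n → K)]
  simp only [Finset.mem_univ, if_true]
  linarith [mul_comm (q ^ i) D]

/-- The set partitions of `[n]` such that, for every `i ≤ n / 2`, all but at most `t` of the first
`i` elements are joined by an arc to one of the last `i` elements. -/
def IsNearAntidiagonal (t : ℕ) (π : SetPartition n) : Prop :=
  ∀ i, 2 * i ≤ n → (freeRows π i (n - i)).card ≤ t

open scoped Classical in
/-- Markov's inequality for the sizes of the left kernels, and a union bound over the corners. -/
lemma sum_realSPl_not_isNearAntidiagonal_le (K : Type*) [Field K] [Finite K] (n t : ℕ) :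
    ∑ π : SetPartition n with ¬ IsNearAntidiagonal t π, realSPl K π ≤ (n + 1) / 2 ^ t := by
  have := Fintype.ofFinite K
  set D := Fintype.card (Module.Dual K (strictUpper K n)) with hD
  have hD0 : 0 < (D : ℝ) := by
    rw [hD]
    exact_mod_cast Fintype.card_pos
  let bad : ℕ → Finset (Module.Dual K (strictUpper K n)) := fun i =>
    {l | 2 * i ≤ n ∧ t < (freeRows (shape l) i (n - i)).card}
  have hbad : ∀ i, (bad i).card * 2 ^ t ≤ D := by
    intro i
    by_cases hi : 2 * i ≤ n
    · have h1 : (bad i).card * 2 ^ (t + 1) ≤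
          ∑ l : Module.Dual K (strictUpper K n), (leftKer i (n - i) l).ncard := by
        rw [← smul_eq_mul, ← Finset.sum_const]
        refine (Finset.sum_le_sum fun l hl => ?_).trans
          (Finset.sum_le_sum_of_subset (Finset.subset_univ (bad i)))
        rw [ncard_leftKer (by omega)]
        have hl : t < (freeRows (shape l) i (n - i)).card := (Finset.mem_filter.1 hl).2.2
        exact (Nat.pow_le_pow_left Fintype.one_lt_card _).trans
          (Nat.pow_le_pow_right Fintype.card_pos hl)
      have h2 := h1.trans (sum_ncard_leftKer_le hi)
      rw [pow_succ] at h2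
      linarith
    · have : bad i = ∅ := by simp [bad, hi]
      simp [this]
  have hsum : ∑ π : SetPartition n with ¬ IsNearAntidiagonal t π, realSPl K π =
      ((Finset.univ.filter fun l : Module.Dual K (strictUpper K n) =>
        ¬ IsNearAntidiagonal t (shape l)).card : ℝ) / D := by
    rw [Finset.card_eq_sum_card_fiberwise (f := shape)
      (t := Finset.univ.filter fun π : SetPartition n => ¬ IsNearAntidiagonal t π)
      (fun l hl => by simpa using hl), Nat.cast_sum, Finset.sum_div]
    refine Finset.sum_congr rfl fun π hπ => ?_
    rw [realSPl]
    congr 3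
    ext l
    simp only [mem_shapeClass, Finset.mem_filter, Finset.mem_univ, true_and]
    exact ⟨fun h => ⟨h ▸ (Finset.mem_filter.1 hπ).2, h⟩, fun h => h.2⟩
  have hcard : (Finset.univ.filter fun l : Module.Dual K (strictUpper K n) =>
      ¬ IsNearAntidiagonal t (shape l)).card ≤ ∑ i ∈ Finset.range (n + 1), (bad i).card := by
    refine (Finset.card_le_card fun l hl => ?_).trans Finset.card_biUnion_le
    have hl := (Finset.mem_filter.1 hl).2
    simp only [IsNearAntidiagonal, not_forall, not_le] at hl
    obtain ⟨i, hi, h⟩ := hl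
    refine Finset.mem_biUnion.2 ⟨i, Finset.mem_range.2 (by omega), ?_⟩
    exact Finset.mem_filter.2 ⟨Finset.mem_univ _, hi, h⟩
  have hfin : (Finset.univ.filter fun l : Module.Dual K (strictUpper K n) =>
      ¬ IsNearAntidiagonal t (shape l)).card * 2 ^ t ≤ (n + 1) * D := by
    refine (Nat.mul_le_mul_right _ hcard).trans ?_
    rw [Finset.sum_mul]
    refine (Finset.sum_le_sum fun i _ => hbad i).trans ?_
    simp
  rw [hsum, div_le_div_iff₀ hD0 (by positivity)]
  exact_mod_cast hfin

/-- Borel–Cantelli: random set partitions with the superplancherel laws are eventually close to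
the antidiagonal. -/
lemma ae_eventually_isNearAntidiagonal (K : Type*) [Field K] [Finite K] {E : Type*}
    [MeasurableSpace E] (P : Measure E) [IsProbabilityMeasure P]
    (X : (n : ℕ) → E → SetPartition n)
    (hX : ∀ n, 1 ≤ n → ∀ π : SetPartition n, P.real {e | X n e = π} = realSPl K π) :
    ∀ᵐ e ∂P, ∀ᶠ n in atTop, IsNearAntidiagonal (3 * Nat.log 2 n + 3) (X n e) := by
  classical
  have hbound : ∀ n, 1 ≤ n →
      P {e | ¬ IsNearAntidiagonal (3 * Nat.log 2 n + 3) (X n e)} ≤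
        ENNReal.ofReal (2 / (n : ℝ) ^ 2) := by
    intro n hn
    have hsub : {e | ¬ IsNearAntidiagonal (3 * Nat.log 2 n + 3) (X n e)} ⊆
        ⋃ π ∈ Finset.univ.filter fun π : SetPartition n =>
          ¬ IsNearAntidiagonal (3 * Nat.log 2 n + 3) π, {e | X n e = π} := by
      intro e he
      exact Set.mem_biUnion (Finset.mem_coe.2 (Finset.mem_filter.2 ⟨Finset.mem_univ _, he⟩)) rfl
    refine (measure_mono hsub).trans ((measure_biUnion_finset_le _ _).trans ?_)
    have h1 : ∀ π : SetPartition n, P {e | X n e = π} = ENNReal.ofReal (realSPl K π) := by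
      intro π
      rw [← hX n hn π, ofReal_measureReal]
    rw [Finset.sum_congr rfl fun π _ => h1 π, ← ENNReal.ofReal_sum_of_nonneg fun π _ => by
      unfold realSPl; positivity]
    refine ENNReal.ofReal_le_ofReal
      ((sum_realSPl_not_isNearAntidiagonal_le K n _).trans ?_)
    have h2 : (n : ℝ) ^ 3 ≤ 2 ^ (3 * Nat.log 2 n + 3) := by
      have : n ^ 3 ≤ 2 ^ (3 * Nat.log 2 n + 3) := by
        have h := (Nat.lt_pow_succ_log_self one_lt_two n).le
        calc n ^ 3 ≤ (2 ^ (Nat.log 2 n + 1)) ^ 3 := Nat.pow_le_pow_left h 3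
          _ = 2 ^ (3 * Nat.log 2 n + 3) := by rw [← pow_mul]; ring_nf
      exact_mod_cast this
    have hn' : (1 : ℝ) ≤ n := by exact_mod_cast hn
    calc ((n : ℝ) + 1) / 2 ^ (3 * Nat.log 2 n + 3) ≤ (2 * n) / (n : ℝ) ^ 3 := by
          gcongr
          linarith
      _ = 2 / (n : ℝ) ^ 2 := by field_simp
  have hfin : ∑' n, P {e | 1 ≤ n ∧ ¬ IsNearAntidiagonal (3 * Nat.log 2 n + 3) (X n e)} ≠ ∞ := by
    have hs : Summable fun n : ℕ => 2 / (n : ℝ) ^ 2 := by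
      simpa [div_eq_mul_inv] using (Real.summable_nat_pow_inv.2 one_lt_two).mul_left 2
    refine ne_top_of_le_ne_top hs.tsum_ofReal_ne_top (ENNReal.tsum_le_tsum fun n => ?_)
    by_cases hn : 1 ≤ n
    · exact (measure_mono fun e he => he.2).trans (hbound n hn)
    · simp [hn]
  filter_upwards [ae_eventually_notMem hfin] with e he
  filter_upwards [he, eventually_ge_atTop 1] with n hn h1
  by_contra h
  exact hn ⟨h1, h⟩

end Random

/-! ### Convergence to the antidiagonal -/

section Combinatorics

variable {n t : ℕ} {π : SetPartition n}

lemma fst_injOn_arcs (π : SetPartition n) :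
    Set.InjOn Prod.fst (arcs π : Set (Fin n × Fin n)) := by
  rintro ⟨a, b⟩ h ⟨a', b'⟩ h' rfl
  rw [arcs_right_unique (Finset.mem_coe.1 h) (Finset.mem_coe.1 h')]

lemma snd_injOn_arcs (π : SetPartition n) :
    Set.InjOn Prod.snd (arcs π : Set (Fin n × Fin n)) := by
  rintro ⟨a, b⟩ h ⟨a', b'⟩ h' rfl
  rw [arcs_left_unique (Finset.mem_coe.1 h) (Finset.mem_coe.1 h')]

lemma card_arcs_before_le (hπ : IsNearAntidiagonal t π) {i : ℕ} (hi : 2 * i ≤ n) :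
    ((arcs π).filter fun p => (p.1 : ℕ) < i ∧ (p.2 : ℕ) < n - i).card ≤ t := by
  refine le_trans (Finset.card_le_card_of_injOn Prod.fst ?_
    ((fst_injOn_arcs π).mono (Finset.coe_subset.2 (Finset.filter_subset _ _)))) (hπ i hi)
  rintro ⟨a, b⟩ h
  have h := Finset.mem_filter.1 (Finset.mem_coe.1 h)
  refine Finset.mem_coe.2 (mem_freeRows.2 ⟨h.2.1, fun b' hb' => ?_⟩)
  rw [arcs_right_unique hb' h.1]
  exact h.2.2

/-- The last `i` columns contain at most `i` arcs, and all but `t` of these slots are used by arcs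
from the first `i` rows. -/
lemma card_arcs_after_le (hπ : IsNearAntidiagonal t π) {i : ℕ} (hi : 2 * i ≤ n) :
    ((arcs π).filter fun p => i ≤ (p.1 : ℕ) ∧ n - i ≤ (p.2 : ℕ)).card ≤ t := by
  classical
  let B := (arcs π).filter fun p => n - i ≤ (p.2 : ℕ)
  have hB : B.card ≤ i := by
    have h1 : B.card ≤ (Finset.univ.filter fun b : Fin n => n - i ≤ (b : ℕ)).card := by
      refine Finset.card_le_card_of_injOn Prod.snd (fun p hp => ?_)
        ((snd_injOn_arcs π).mono (Finset.coe_subset.2 (Finset.filter_subset _ _)))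
      simpa using (Finset.mem_filter.1 (Finset.mem_coe.1 hp)).2
    rwa [← Fintype.card_subtype, card_subtype_ge (by omega)] at h1
  have hrows : i ≤ t + (B.filter fun p => (p.1 : ℕ) < i).card := by
    have h1 : (Finset.univ.filter fun a : Fin n => (a : ℕ) < i) ⊆
        freeRows π i (n - i) ∪ (B.filter fun p => (p.1 : ℕ) < i).image Prod.fst := by
      intro a ha
      have ha : (a : ℕ) < i := by simpa using ha
      by_cases h : a ∈ freeRows π i (n - i)
      · exact Finset.mem_union_left _ h
      · simp only [mem_freeRows, ha, true_and, not_forall, not_lt] at h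
        obtain ⟨b, hab, hb⟩ := h
        exact Finset.mem_union_right _ (Finset.mem_image.2
          ⟨(a, b), Finset.mem_filter.2 ⟨Finset.mem_filter.2 ⟨hab, hb⟩, ha⟩, rfl⟩)
    have h2 := (Finset.card_le_card h1).trans ((Finset.card_union_le _ _).trans
      (Nat.add_le_add (hπ i hi) Finset.card_image_le))
    rwa [Fin.card_filter_val_lt, min_eq_right (by omega)] at h2
  have hsplit := Finset.card_filter_add_card_filter_not (s := B) fun p => (p.1 : ℕ) < i
  have heq : ((arcs π).filter fun p => i ≤ (p.1 : ℕ) ∧ n - i ≤ (p.2 : ℕ)) =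
      B.filter fun p => ¬ (p.1 : ℕ) < i := by
    ext p
    simp only [B, Finset.mem_filter, not_lt]
    tauto
  rw [heq]
  omega

/-- An arc starting in the right half of `[n]` also ends there, and it is counted by
`card_arcs_after_le` for `i = n / 2`. -/
lemma card_arcs_right_half_le (hπ : IsNearAntidiagonal t π) :
    ((arcs π).filter fun p => ¬ (p.1 : ℕ) < n / 2).card ≤ t := by
  refine (Finset.card_le_card fun p hp => ?_).trans
    (card_arcs_after_le hπ (i := n / 2) (by omega))
  obtain ⟨hp, hle⟩ := Finset.mem_filter.1 hp
  have hlt := Fin.lt_def.1 (mem_arcs.1 hp).1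
  exact Finset.mem_filter.2 ⟨hp, by omega, by omega⟩

lemma card_rows_without_arc_le (hπ : IsNearAntidiagonal t π) :
    (Finset.univ.filter fun a : Fin n => (a : ℕ) < n / 2 ∧ ∀ b, (a, b) ∉ arcs π).card ≤ t := by
  refine (Finset.card_le_card fun a ha => ?_).trans (hπ (n / 2) (by omega))
  have ha := (Finset.mem_filter.1 ha).2
  exact mem_freeRows.2 ⟨ha.1, fun b hb => absurd hb (ha.2 b)⟩

lemma card_left_arcs_le (π : SetPartition n) :
    ((arcs π).filter fun p => (p.1 : ℕ) < n / 2).card ≤ n := by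
  refine le_trans (Finset.card_le_card_of_injOn Prod.fst (fun _ _ => Finset.mem_coe.2
    (Finset.mem_univ _)) ((fst_injOn_arcs π).mono (Finset.coe_subset.2
    (Finset.filter_subset _ _)))) ?_
  simp

/-- The total distance to the antidiagonal of the arcs `(a, b)` starting in the left half. The
summand is `|a + b + 1 - n|`, written as the sum of two truncated differences, one of which
vanishes. If `b` is in the right half, it counts the indices `i ≤ n / 2` such that exactly one of `a < i` and
`n - i ≤ b` holds, and for each `i` at most `2 t` arcs have this property. -/
lemma sum_dist_antidiagonal_le (hπ : IsNearAntidiagonal t π) :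
    ∑ p ∈ arcs π with (p.1 : ℕ) < n / 2,
      (((p.1 : ℕ) + p.2 + 1 - n) + (n - 1 - p.1 - p.2)) ≤ 3 * n * t := by
  classical
  rcases Nat.eq_zero_or_pos n with rfl | hn
  · rw [Finset.sum_eq_zero fun p _ => p.1.elim0]
    simp
  let A := (arcs π).filter fun p => (p.1 : ℕ) < n / 2
  have hpoint : ∀ p ∈ A, ((p.1 : ℕ) + p.2 + 1 - n) + (n - 1 - p.1 - p.2) ≤
      (∑ i ∈ Finset.range (n / 2 + 1), if i ≤ (p.1 : ℕ) ∧ n - i ≤ (p.2 : ℕ) then 1 else 0) +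
      (∑ i ∈ Finset.range (n / 2 + 1), if (p.1 : ℕ) < i ∧ (p.2 : ℕ) < n - i then 1 else 0) +
      if (p.1 : ℕ) < n / 2 ∧ (p.2 : ℕ) < n - n / 2 then n else 0 := by
    rintro ⟨a, b⟩ hp
    have ha : (a : ℕ) < n / 2 := (Finset.mem_filter.1 hp).2
    have hb := b.2
    rw [Finset.sum_boole, Finset.sum_boole, Nat.cast_id, Nat.cast_id]
    have h1 : (a : ℕ) + b + 1 - n ≤ ((Finset.range (n / 2 + 1)).filter
        fun i => i ≤ (a : ℕ) ∧ n - i ≤ (b : ℕ)).card := by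
      have : Finset.Icc (n - b) (a : ℕ) ⊆ (Finset.range (n / 2 + 1)).filter
          fun i => i ≤ (a : ℕ) ∧ n - i ≤ (b : ℕ) := by
        intro i hi
        rw [Finset.mem_Icc] at hi
        rw [Finset.mem_filter, Finset.mem_range]
        omega
      have := Finset.card_le_card this
      rw [Nat.card_Icc] at this
      omega
    by_cases hbm : (b : ℕ) < n - n / 2
    · rw [if_pos ⟨ha, hbm⟩]
      simp only
      omega
    · rw [if_neg fun h => hbm h.2]
      have h2 : n - 1 - a - b ≤ ((Finset.range (n / 2 + 1)).filter
          fun i => (a : ℕ) < i ∧ (b : ℕ) < n - i).card := by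
        have : Finset.Ioo (a : ℕ) (n - b) ⊆ (Finset.range (n / 2 + 1)).filter
            fun i => (a : ℕ) < i ∧ (b : ℕ) < n - i := by
          intro i hi
          rw [Finset.mem_Ioo] at hi
          rw [Finset.mem_filter, Finset.mem_range]
          omega
        have := Finset.card_le_card this
        rw [Nat.card_Ioo] at this
        omega
      simp only
      omega
  have hA : A ⊆ arcs π := Finset.filter_subset _ _
  have hs1 : ∑ p ∈ A, ∑ i ∈ Finset.range (n / 2 + 1),
      (if i ≤ (p.1 : ℕ) ∧ n - i ≤ (p.2 : ℕ) then 1 else 0) ≤ (n / 2 + 1) * t := by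
    rw [Finset.sum_comm]
    refine (Finset.sum_le_card_nsmul _ _ t fun i hi => ?_).trans (by simp)
    rw [Finset.sum_boole, Nat.cast_id]
    have hi := Finset.mem_range.1 hi
    exact (Finset.card_le_card (Finset.filter_subset_filter _ hA)).trans
      (card_arcs_after_le hπ (by omega))
  have hs2 : ∑ p ∈ A, ∑ i ∈ Finset.range (n / 2 + 1),
      (if (p.1 : ℕ) < i ∧ (p.2 : ℕ) < n - i then 1 else 0) ≤ (n / 2 + 1) * t := by
    rw [Finset.sum_comm]
    refine (Finset.sum_le_card_nsmul _ _ t fun i hi => ?_).trans (by simp)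
    rw [Finset.sum_boole, Nat.cast_id]
    have hi := Finset.mem_range.1 hi
    exact (Finset.card_le_card (Finset.filter_subset_filter _ hA)).trans
      (card_arcs_before_le hπ (by omega))
  have hs3 : ∑ p ∈ A, (if (p.1 : ℕ) < n / 2 ∧ (p.2 : ℕ) < n - n / 2 then n else 0) ≤ n * t := by
    rw [← Finset.sum_filter, Finset.sum_const, smul_eq_mul, mul_comm]
    exact Nat.mul_le_mul_left _ ((Finset.card_le_card (Finset.filter_subset_filter _ hA)).trans
      (card_arcs_before_le hπ (by omega)))
  refine (Finset.sum_le_sum hpoint).trans ?_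
  rw [Finset.sum_add_distrib, Finset.sum_add_distrib]
  have h4 : (n / 2 + 1) * t ≤ n * t := Nat.mul_le_mul_right _ (by omega)
  have h5 : 3 * n * t = n * t + n * t + n * t := by ring
  omega

end Combinatorics

section Analysis

/-- A modulus of continuity of the form `η + L dist`, for a function bounded by `C`. -/
lemma exists_affine_modulus (f : BoundedContinuousFunction (ℝ × ℝ) ℝ) {η : ℝ} (hη : 0 < η) :
    ∃ L : ℝ, 0 ≤ L ∧ ∀ p ∈ Set.Icc (0 : ℝ) 1 ×ˢ Set.Icc (0 : ℝ) 1,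
      ∀ q ∈ Set.Icc (0 : ℝ) 1 ×ˢ Set.Icc (0 : ℝ) 1, |f p - f q| ≤ η + L * dist p q := by
  have huc := (isCompact_Icc.prod isCompact_Icc).uniformContinuousOn_of_continuous
    (f.continuous.continuousOn (s := Set.Icc (0 : ℝ) 1 ×ˢ Set.Icc (0 : ℝ) 1))
  obtain ⟨δ, hδ, h⟩ := Metric.uniformContinuousOn_iff.1 huc η hη
  refine ⟨2 * ‖f‖ / δ, by positivity, fun p hp q hq => ?_⟩
  have h0 : 0 ≤ 2 * ‖f‖ / δ * dist p q := by positivity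
  rcases lt_or_ge (dist p q) δ with hd | hd
  · have := (h p hp q hq hd).le
    rw [Real.dist_eq] at this
    linarith
  · have h1 : |f p - f q| ≤ 2 * ‖f‖ := by
      rw [← Real.dist_eq]
      exact f.dist_le_two_norm p q
    have h2 : 2 * ‖f‖ ≤ 2 * ‖f‖ / δ * dist p q := by
      rw [div_mul_eq_mul_div, le_div_iff₀ hδ]
      exact mul_le_mul_of_nonneg_left hd (by positivity)
    linarith

variable {n : ℕ}

lemma isProbabilityMeasure_cond_square (hn : 0 < n) (i j : Fin n) :
    IsProbabilityMeasure (ProbabilityTheory.cond volume (square i j)) := by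
  have hn : (0 : ℝ) < n := by exact_mod_cast hn
  have hvol : volume (square i j) = ENNReal.ofReal (1 / n) * ENNReal.ofReal (1 / n) := by
    rw [square, Measure.volume_eq_prod, Measure.prod_prod, Real.volume_Icc, Real.volume_Icc]
    congr 2 <;> ring
  refine ProbabilityTheory.cond_isProbabilityMeasure_of_finite ?_ ?_
  · rw [hvol]
    have : 0 < ENNReal.ofReal (1 / n) := ENNReal.ofReal_pos.2 (by positivity)
    exact (ENNReal.mul_pos this.ne' this.ne').ne'
  · rw [hvol]
    exact ENNReal.mul_ne_top ENNReal.ofReal_ne_top ENNReal.ofReal_ne_top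

lemma measurableSet_square (i j : Fin n) : MeasurableSet (square i j) :=
  measurableSet_Icc.prod measurableSet_Icc

lemma square_subset_unitSquare (i j : Fin n) :
    square i j ⊆ Set.Icc (0 : ℝ) 1 ×ˢ Set.Icc (0 : ℝ) 1 := by
  have key : ∀ i : Fin n, Set.Icc ((i : ℝ) / n) (((i : ℝ) + 1) / n) ⊆ Set.Icc 0 1 := by
    intro i
    have hn : (0 : ℝ) < n := by exact_mod_cast i.pos
    have hi : (i : ℝ) + 1 ≤ n := by exact_mod_cast i.2
    exact Set.Icc_subset_Icc (by positivity) ((div_le_one hn).2 hi)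
  exact Set.prod_mono (key i) (key j)

lemma square_subset_triangle {i j : Fin n} (hij : i < j) : square i j ⊆ triangle := by
  intro p hp
  have h := square_subset_unitSquare i j hp
  refine ⟨h.1, h.2, hp.1.2.trans (le_trans ?_ hp.2.1)⟩
  have hn : (0 : ℝ) < n := by exact_mod_cast i.pos
  have hij : (i : ℝ) + 1 ≤ j := by exact_mod_cast Fin.lt_def.1 hij
  gcongr

lemma abs_integral_cond_square_le (f : BoundedContinuousFunction (ℝ × ℝ) ℝ) (i j : Fin n) :
    |∫ p, f p ∂(ProbabilityTheory.cond volume (square i j))| ≤ ‖f‖ := by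
  have := isProbabilityMeasure_cond_square i.pos i j
  exact f.norm_integral_le_norm (μ := ProbabilityTheory.cond volume (square i j))

/-- The average of a test function over the square of an arc `(i, j)` is close to its value at the
point of the antidiagonal above `i / n`, in terms of `|i + j + 1 - n|` written as the sum of two
truncated differences. -/
lemma abs_integral_cond_square_sub_le (f : BoundedContinuousFunction (ℝ × ℝ) ℝ) {η L : ℝ}
    (hL0 : 0 ≤ L) (hL : ∀ p ∈ Set.Icc (0 : ℝ) 1 ×ˢ Set.Icc (0 : ℝ) 1,
      ∀ q ∈ Set.Icc (0 : ℝ) 1 ×ˢ Set.Icc (0 : ℝ) 1, |f p - f q| ≤ η + L * dist p q)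
    (i j : Fin n) :
    |∫ p, f p ∂(ProbabilityTheory.cond volume (square i j)) - f ((i : ℝ) / n, 1 - (i : ℝ) / n)| ≤
      η + L * (((((i : ℕ) + j + 1 - n) + (n - 1 - i - j) : ℕ) + 2) / n) := by
  have := isProbabilityMeasure_cond_square i.pos i j
  have hn : (0 : ℝ) < n := by exact_mod_cast i.pos
  set μ := ProbabilityTheory.cond volume (square i j) with hμ
  set q : ℝ × ℝ := ((i : ℝ) / n, 1 - (i : ℝ) / n) with hq
  have hi0 : 0 ≤ (i : ℝ) / n := by positivity
  have hi1 : (i : ℝ) / n ≤ 1 := (div_le_one hn).2 (by exact_mod_cast i.2.le)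
  have hq1 : q ∈ Set.Icc (0 : ℝ) 1 ×ˢ Set.Icc (0 : ℝ) 1 :=
    ⟨⟨hi0, hi1⟩, ⟨by simp only [hq]; linarith, by simp only [hq]; linarith⟩⟩
  have hint : ∫ p, f p ∂μ - f q = ∫ p, (f p - f q) ∂μ := by
    rw [integral_sub (f.integrable μ) (integrable_const _)]
    simp
  rw [hint]
  suffices h : ∀ᵐ p ∂μ, ‖f p - f q‖ ≤
      η + L * (((((i : ℕ) + j + 1 - n) + (n - 1 - i - j) : ℕ) + 2) / n) by
    have hb := norm_integral_le_of_norm_le_const h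
    rwa [probReal_univ, mul_one] at hb
  filter_upwards [ProbabilityTheory.ae_cond_mem (measurableSet_square i j)] with p hp
  refine (hL p (square_subset_unitSquare i j hp) q hq1).trans ?_
  have habs : |(i : ℝ) + j + 1 - n| ≤ (((i : ℕ) + j + 1 - n) + (n - 1 - i - j) : ℕ) := by
    have h1 : (i : ℤ) + j + 1 - n ≤ (((i : ℕ) + j + 1 - n) + (n - 1 - i - j) : ℕ) := by omega
    have h2 : -((((i : ℕ) + j + 1 - n) + (n - 1 - i - j) : ℕ) : ℤ) ≤ (i : ℤ) + j + 1 - n := by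
      omega
    exact abs_le.2 ⟨by exact_mod_cast h2, by exact_mod_cast h1⟩
  gcongr
  have e1 : ((i : ℝ) + 1) / n = (i : ℝ) / n + 1 / n := add_div _ _ _
  have e2 : ((j : ℝ) + 1) / n = (j : ℝ) / n + 1 / n := add_div _ _ _
  have e3 : ((i : ℝ) + j + 1 - n) / n = (i : ℝ) / n + (j : ℝ) / n + 1 / n - 1 := by
    rw [sub_div, add_div, add_div, div_self hn.ne']
  have hpos : 0 < 1 / (n : ℝ) := by positivity
  obtain ⟨⟨hp1, hp2⟩, hp3, hp4⟩ := hp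
  rw [e1] at hp2
  rw [e2] at hp4
  have habs' : |(i : ℝ) / n + (j : ℝ) / n + 1 / n - 1| ≤
      (((i : ℕ) + j + 1 - n) + (n - 1 - i - j) : ℕ) / (n : ℝ) := by
    rw [← e3, abs_div, abs_of_pos hn]
    gcongr
  obtain ⟨h1, h2⟩ := abs_le.1 habs'
  rw [Prod.dist_eq, Real.dist_eq, Real.dist_eq, add_div]
  have e4 : (2 : ℝ) / n = 1 / n + 1 / n := by ring
  rw [e4]
  have h0 : 0 ≤ ((((i : ℕ) + j + 1 - n) + (n - 1 - i - j) : ℕ) : ℝ) / (n : ℝ) := by positivity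
  refine max_le (abs_le.2 ⟨?_, ?_⟩) (abs_le.2 ⟨?_, ?_⟩) <;> simp only [hq] <;> linarith

end Analysis

section Convergence

variable {n t : ℕ}

lemma integral_planeMeasure (f : BoundedContinuousFunction (ℝ × ℝ) ℝ) (π : SetPartition n) :
    ∫ p, f p ∂(planeMeasure π) =
      (n : ℝ)⁻¹ * ∑ a ∈ arcs π, ∫ p, f p ∂(ProbabilityTheory.cond volume (square a.1 a.2)) := by
  rw [planeMeasure, integral_smul_nnreal_measure, integral_finsetSum_measure]
  · simp [NNReal.smul_def]
  · intro a _
    have := isProbabilityMeasure_cond_square a.1.pos a.1 a.2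
    exact f.integrable _

/-- The integral of a test function against `μ_π` is close to a Riemann sum along the
antidiagonal. -/
lemma abs_integral_planeMeasure_sub_le (f : BoundedContinuousFunction (ℝ × ℝ) ℝ) {η L : ℝ}
    (hη : 0 ≤ η) (hL0 : 0 ≤ L) (hL : ∀ p ∈ Set.Icc (0 : ℝ) 1 ×ˢ Set.Icc (0 : ℝ) 1,
      ∀ q ∈ Set.Icc (0 : ℝ) 1 ×ˢ Set.Icc (0 : ℝ) 1, |f p - f q| ≤ η + L * dist p q)
    (hn : 0 < n) {π : SetPartition n} (hπ : IsNearAntidiagonal t π) :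
    |∫ p, f p ∂(planeMeasure π) -
        (n : ℝ)⁻¹ * ∑ a ∈ Finset.range (n / 2), f ((a : ℝ) / n, 1 - (a : ℝ) / n)| ≤
      η + (L * (3 * t + 2) + 2 * ‖f‖ * t) / n := by
  classical
  have hn' : (0 : ℝ) < n := by exact_mod_cast hn
  set F : ℕ → ℝ := fun a => f ((a : ℝ) / n, 1 - (a : ℝ) / n) with hF
  set g : Fin n × Fin n → ℝ := fun a =>
    ∫ p, f p ∂(ProbabilityTheory.cond volume (square a.1 a.2)) with hg
  set A := (arcs π).filter fun p => (p.1 : ℕ) < n / 2 with hA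
  set A' := (arcs π).filter fun p => ¬ (p.1 : ℕ) < n / 2 with hA'
  set R := Finset.univ.filter fun a : Fin n => (a : ℕ) < n / 2 ∧ ∀ b, (a, b) ∉ arcs π with hR
  have hFsum : ∑ a ∈ Finset.range (n / 2), F a = ∑ p ∈ A, F p.1 + ∑ a ∈ R, F a := by
    have h1 : ∑ p ∈ A, F p.1 = ∑ a ∈ A.image Prod.fst, F a := by
      rw [Finset.sum_image]
      exact (fst_injOn_arcs π).mono (Finset.coe_subset.2 (Finset.filter_subset _ _))
    have h2 : Disjoint (A.image Prod.fst) R := by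
      rw [Finset.disjoint_left]
      intro a ha haR
      obtain ⟨⟨a, b⟩, hp, rfl⟩ := Finset.mem_image.1 ha
      exact (Finset.mem_filter.1 haR).2.2 b (Finset.mem_filter.1 hp).1
    rw [h1, ← Finset.sum_union h2]
    symm
    refine Finset.sum_nbij (fun a => (a : ℕ)) ?_ Fin.val_injective.injOn ?_ fun _ _ => rfl
    · intro a ha
      rw [Finset.mem_range]
      rcases Finset.mem_union.1 ha with ha | ha
      · obtain ⟨p, hp, rfl⟩ := Finset.mem_image.1 ha
        exact (Finset.mem_filter.1 hp).2
      · exact (Finset.mem_filter.1 ha).2.1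
    · intro a ha
      have ha : a < n / 2 := Finset.mem_range.1 (Finset.mem_coe.1 ha)
      refine ⟨⟨a, by omega⟩, Finset.mem_coe.2 (Finset.mem_union.2 ?_), rfl⟩
      by_cases h : ∃ b, ((⟨a, by omega⟩ : Fin n), b) ∈ arcs π
      · obtain ⟨b, hb⟩ := h
        exact Or.inl (Finset.mem_image.2 ⟨_, Finset.mem_filter.2 ⟨hb, ha⟩, rfl⟩)
      · exact Or.inr (Finset.mem_filter.2 ⟨Finset.mem_univ _, ha, not_exists.1 h⟩)
  have hgsum : ∑ p ∈ arcs π, g p = ∑ p ∈ A, g p + ∑ p ∈ A', g p :=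
    (Finset.sum_filter_add_sum_filter_not _ _ _).symm
  have b1 : |∑ p ∈ A, (g p - F p.1)| ≤ n * η + L * (3 * t + 2) := by
    refine (Finset.abs_sum_le_sum_abs _ _).trans
      ((Finset.sum_le_sum fun p _ => abs_integral_cond_square_sub_le f hL0 hL p.1 p.2).trans ?_)
    rw [Finset.sum_add_distrib, ← Finset.mul_sum, ← Finset.sum_div, Finset.sum_add_distrib,
      Finset.sum_const, Finset.sum_const, nsmul_eq_mul, nsmul_eq_mul, ← Nat.cast_sum]
    have hc : (A.card : ℝ) ≤ n := by exact_mod_cast card_left_arcs_le π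
    have hs : ((∑ p ∈ A, (((p.1 : ℕ) + p.2 + 1 - n) + (n - 1 - p.1 - p.2)) : ℕ) : ℝ) ≤
        3 * n * t := by exact_mod_cast sum_dist_antidiagonal_le hπ
    gcongr
    rw [div_le_iff₀ hn']
    nlinarith
  have b2 : |∑ p ∈ A', g p| ≤ ‖f‖ * t := by
    refine (Finset.abs_sum_le_sum_abs _ _).trans ((Finset.sum_le_sum fun p _ =>
      abs_integral_cond_square_le f p.1 p.2).trans ?_)
    rw [Finset.sum_const, nsmul_eq_mul, mul_comm]
    gcongr
    exact card_arcs_right_half_le hπ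
  have b3 : |∑ a ∈ R, F a| ≤ ‖f‖ * t := by
    refine (Finset.abs_sum_le_sum_abs _ _).trans ((Finset.sum_le_sum fun a _ =>
      f.norm_coe_le_norm _).trans ?_)
    rw [Finset.sum_const, nsmul_eq_mul, mul_comm]
    gcongr
    exact card_rows_without_arc_le hπ
  rw [integral_planeMeasure, ← mul_sub, abs_mul, abs_of_pos (inv_pos.2 hn'), hgsum, hFsum]
  have heq : ∑ p ∈ A, g p + ∑ p ∈ A', g p - (∑ p ∈ A, F p.1 + ∑ a ∈ R, F a) =
      ∑ p ∈ A, (g p - F p.1) + ∑ p ∈ A', g p - ∑ a ∈ R, F a := by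
    rw [Finset.sum_sub_distrib]
    ring
  rw [heq, inv_mul_le_iff₀ hn', mul_add, mul_div_cancel₀ _ hn'.ne']
  refine (abs_sub _ _).trans ((add_le_add (abs_add_le _ _) le_rfl).trans ?_)
  linarith

lemma integral_planeLimit (f : BoundedContinuousFunction (ℝ × ℝ) ℝ) :
    ∫ p, f p ∂planeLimit = ∫ x in (0 : ℝ)..(1 / 2), f (x, 1 - x) := by
  rw [planeLimit, integral_map (by fun_prop) f.continuous.aestronglyMeasurable,
    integral_Icc_eq_integral_Ioc, intervalIntegral.integral_of_le (by norm_num)]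

lemma abs_riemannSum_sub_integral_le (f : BoundedContinuousFunction (ℝ × ℝ) ℝ) {η L : ℝ}
    (hη : 0 ≤ η) (hL0 : 0 ≤ L) (hL : ∀ p ∈ Set.Icc (0 : ℝ) 1 ×ˢ Set.Icc (0 : ℝ) 1,
      ∀ q ∈ Set.Icc (0 : ℝ) 1 ×ˢ Set.Icc (0 : ℝ) 1, |f p - f q| ≤ η + L * dist p q)
    (hn : 0 < n) :
    |(n : ℝ)⁻¹ * ∑ a ∈ Finset.range (n / 2), f ((a : ℝ) / n, 1 - (a : ℝ) / n) -
        ∫ p, f p ∂planeLimit| ≤ η + (L + ‖f‖) / n := by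
  have hn' : (0 : ℝ) < n := by exact_mod_cast hn
  set h : ℝ → ℝ := fun x => f (x, 1 - x) with hh
  have hcont : Continuous h := f.continuous.comp (by fun_prop)
  have hii : ∀ a b : ℝ, IntervalIntegrable h volume a b := fun a b => hcont.intervalIntegrable a b
  have hm : ((n / 2 : ℕ) : ℝ) ≤ n / 2 := Nat.cast_div_le
  have hm' : (n : ℝ) ≤ 2 * ((n / 2 : ℕ) : ℝ) + 1 := by
    have : n ≤ 2 * (n / 2) + 1 := by omega
    exact_mod_cast this
  have hsplit : ∫ x in (0 : ℝ)..(1 / 2), h x =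
      ∑ a ∈ Finset.range (n / 2), (∫ x in ((a : ℝ) / n)..(((a + 1 : ℕ) : ℝ) / n), h x) +
        ∫ x in (((n / 2 : ℕ) : ℝ) / n)..(1 / 2), h x := by
    rw [intervalIntegral.sum_integral_adjacent_intervals (a := fun k : ℕ => (k : ℝ) / n)
      fun k _ => hii _ _]
    simp only [Nat.cast_zero, zero_div]
    rw [intervalIntegral.integral_add_adjacent_intervals (hii _ _) (hii _ _)]
  have hlast : |∫ x in (((n / 2 : ℕ) : ℝ) / n)..(1 / 2), h x| ≤ ‖f‖ / n := by
    refine (intervalIntegral.norm_integral_le_of_norm_le_const (C := ‖f‖)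
      fun x _ => f.norm_coe_le_norm _).trans ?_
    rw [div_eq_mul_inv ‖f‖]
    gcongr
    have e : (1 / 2 - ((n / 2 : ℕ) : ℝ) / n) = (n / 2 - ((n / 2 : ℕ) : ℝ)) * (n : ℝ)⁻¹ := by
      field_simp
    rw [e, abs_of_nonneg (mul_nonneg (by linarith) (by positivity))]
    exact mul_le_of_le_one_left (by positivity) (by linarith)
  have hpiece : ∀ a ∈ Finset.range (n / 2),
      |(n : ℝ)⁻¹ * h ((a : ℝ) / n) - ∫ x in ((a : ℝ) / n)..(((a + 1 : ℕ) : ℝ) / n), h x| ≤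
        (η + L * (n : ℝ)⁻¹) * (n : ℝ)⁻¹ := by
    intro a ha
    have ha : a + 1 ≤ n := by
      have := Finset.mem_range.1 ha
      omega
    have ha' : ((a + 1 : ℕ) : ℝ) / n ≤ 1 := (div_le_one hn').2 (by exact_mod_cast ha)
    have e1 : ((a + 1 : ℕ) : ℝ) / n = (a : ℝ) / n + (n : ℝ)⁻¹ := by
      push_cast
      ring
    have hpos : 0 < (n : ℝ)⁻¹ := inv_pos.2 hn'
    have ha0 : 0 ≤ (a : ℝ) / n := by positivity
    rw [e1] at ha' ⊢
    have hconst : (n : ℝ)⁻¹ * h ((a : ℝ) / n) =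
        ∫ _ in ((a : ℝ) / n)..((a : ℝ) / n + (n : ℝ)⁻¹), h ((a : ℝ) / n) := by
      rw [intervalIntegral.integral_const, smul_eq_mul]
      ring
    rw [hconst, ← intervalIntegral.integral_sub intervalIntegrable_const (hii _ _)]
    have hbound : ∀ x ∈ Set.uIoc ((a : ℝ) / n) ((a : ℝ) / n + (n : ℝ)⁻¹),
        ‖h ((a : ℝ) / n) - h x‖ ≤ η + L * (n : ℝ)⁻¹ := by
      intro x hx
      rw [Set.uIoc_of_le (by linarith)] at hx
      obtain ⟨hx1, hx2⟩ := hx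
      have hmem : ∀ y : ℝ, 0 ≤ y → y ≤ 1 →
          (y, 1 - y) ∈ Set.Icc (0 : ℝ) 1 ×ˢ Set.Icc (0 : ℝ) 1 := fun y h0 h1 =>
        ⟨⟨h0, h1⟩, ⟨by simpa using h1, by simpa using h0⟩⟩
      refine (hL _ (hmem _ ha0 (by linarith)) _ (hmem x (by linarith) (by linarith))).trans ?_
      gcongr
      rw [Prod.dist_eq, Real.dist_eq, Real.dist_eq]
      exact max_le (abs_le.2 ⟨by simp only; linarith, by simp only; linarith⟩)
        (abs_le.2 ⟨by simp only; linarith, by simp only; linarith⟩)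
    have := intervalIntegral.norm_integral_le_of_norm_le_const hbound
    rwa [add_sub_cancel_left, abs_of_pos hpos] at this
  rw [integral_planeLimit, hsplit, Finset.mul_sum, ← sub_sub, ← Finset.sum_sub_distrib]
  refine (abs_sub _ _).trans ((add_le_add ((Finset.abs_sum_le_sum_abs _ _).trans
    (Finset.sum_le_sum hpiece)) hlast).trans ?_)
  rw [Finset.sum_const, Finset.card_range, nsmul_eq_mul, add_div, ← add_assoc]
  gcongr
  have hle : ((n / 2 : ℕ) : ℝ) * (n : ℝ)⁻¹ ≤ 1 := by
    rw [← div_eq_mul_inv, div_le_one hn']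
    linarith
  calc ((n / 2 : ℕ) : ℝ) * ((η + L * (n : ℝ)⁻¹) * (n : ℝ)⁻¹)
      = (((n / 2 : ℕ) : ℝ) * (n : ℝ)⁻¹) * (η + L * (n : ℝ)⁻¹) := by ring
    _ ≤ 1 * (η + L * (n : ℝ)⁻¹) := by gcongr
    _ = η + L / n := by rw [one_mul, div_eq_mul_inv]

lemma isClosed_triangle : IsClosed triangle :=
  (isClosed_Icc.preimage continuous_fst).inter
    ((isClosed_Icc.preimage continuous_snd).inter (isClosed_le continuous_fst continuous_snd))

lemma integral_onTriangle (μ : Measure (ℝ × ℝ)) [IsFiniteMeasure μ]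
    (hμ : ∀ᵐ p ∂μ, p ∈ triangle) (f : ℝ × ℝ → ℝ) :
    ∫ p : triangle, f p ∂(onTriangle μ : Measure triangle) = ∫ p, f p ∂μ := by
  rw [onTriangle, FiniteMeasure.toMeasure_mk, integral_subtype_comap
    isClosed_triangle.measurableSet, Measure.restrict_eq_self_of_ae_mem hμ]

lemma ae_planeMeasure_mem_triangle (π : SetPartition n) :
    ∀ᵐ p ∂(planeMeasure π), p ∈ triangle := by
  rw [planeMeasure]
  refine Measure.ae_smul_measure ?_ _
  rw [ae_iff, Measure.finsetSum_apply]
  refine Finset.sum_eq_zero fun a ha => ?_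
  rw [← ae_iff]
  filter_upwards [ProbabilityTheory.ae_cond_mem (measurableSet_square a.1 a.2)] with p hp
  exact square_subset_triangle (mem_arcs.1 ha).1 hp

lemma ae_planeLimit_mem_triangle : ∀ᵐ p ∂planeLimit, p ∈ triangle := by
  rw [planeLimit, ae_map_iff (p := (· ∈ triangle)) (by fun_prop) isClosed_triangle.measurableSet]
  filter_upwards [ae_restrict_mem measurableSet_Icc] with x hx
  obtain ⟨h0, h1⟩ := hx
  exact ⟨⟨h0, by simp only; linarith⟩, ⟨by simp only; linarith, by simp only; linarith⟩,
    by simp only; linarith⟩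

lemma tendsto_log_div_atTop (c d : ℝ) :
    Tendsto (fun n : ℕ => (c * Nat.log 2 n + d) / n) atTop (𝓝 0) := by
  have h1 : Tendsto (fun n : ℕ => Real.log n / n) atTop (𝓝 0) :=
    Real.isLittleO_log_id_atTop.tendsto_div_nhds_zero.comp tendsto_natCast_atTop_atTop
  have h2 : Tendsto (fun n : ℕ => (Nat.log 2 n : ℝ) / n) atTop (𝓝 0) := by
    refine squeeze_zero (fun n => by positivity) (fun n => ?_)
      (by simpa using h1.const_mul (Real.log 2)⁻¹)
    have := Real.natLog_le_logb n 2
    rw [Real.logb, Nat.cast_ofNat] at this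
    calc (Nat.log 2 n : ℝ) / n ≤ (Real.log n / Real.log 2) / n := by gcongr
      _ = (Real.log 2)⁻¹ * (Real.log n / n) := by ring
  have h3 : Tendsto (fun n : ℕ => d / (n : ℝ)) atTop (𝓝 0) :=
    tendsto_const_div_atTop_nhds_zero_nat d
  have := (h2.const_mul c).add h3
  rw [mul_zero, add_zero] at this
  refine this.congr fun n => ?_
  ring

/-- Set partitions close to the antidiagonal have associated measures close to the limit. -/
lemma tendsto_partitionMeasure (x : ∀ n, SetPartition n)
    (hx : ∀ᶠ n in atTop, IsNearAntidiagonal (3 * Nat.log 2 n + 3) (x n)) :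
    Tendsto (fun n => partitionMeasure (x n)) atTop (𝓝 limitMeasure) := by
  rw [FiniteMeasure.tendsto_iff_forall_integral_tendsto]
  intro f₀
  obtain ⟨f, -, rfl⟩ :=
    BoundedContinuousFunction.exists_norm_eq_domRestrict_eq_of_closed f₀ isClosed_triangle
  have e1 : ∀ n, ∫ p, f.domRestrict triangle p ∂(partitionMeasure (x n) : Measure triangle) =
      ∫ p, f p ∂(planeMeasure (x n)) := fun n =>
    integral_onTriangle _ (ae_planeMeasure_mem_triangle _) f
  have e2 : ∫ p, f.domRestrict triangle p ∂(limitMeasure : Measure triangle) =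
      ∫ p, f p ∂planeLimit := integral_onTriangle _ ae_planeLimit_mem_triangle f
  simp only [e1, e2]
  rw [Metric.tendsto_atTop']
  intro ε hε
  obtain ⟨L, hL0, hL⟩ := exists_affine_modulus f (η := ε / 4) (by positivity)
  have hlim := tendsto_log_div_atTop ((3 * L + 2 * ‖f‖) * 3)
    ((3 * L + 2 * ‖f‖) * 3 + 2 * L + L + ‖f‖)
  have hev := hx.and ((hlim.eventually_lt_const (show 0 < ε / 2 by positivity)).and
    (eventually_gt_atTop 0))
  obtain ⟨N, hN⟩ := eventually_atTop.1 hev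
  refine ⟨N, fun n hn => ?_⟩
  obtain ⟨hnear, hsmall, hpos⟩ := hN n hn.le
  have h1 := abs_integral_planeMeasure_sub_le f (by positivity) hL0 hL hpos hnear
  have h2 := abs_riemannSum_sub_integral_le f (by positivity) hL0 hL hpos
  rw [Real.dist_eq]
  refine (abs_sub_le _ _ _).trans_lt ((add_le_add h1 h2).trans_lt ?_)
  have e3 : (L * (3 * ((3 * Nat.log 2 n + 3 : ℕ) : ℝ) + 2) +
      2 * ‖f‖ * ((3 * Nat.log 2 n + 3 : ℕ) : ℝ)) / n + (L + ‖f‖) / n =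
      ((3 * L + 2 * ‖f‖) * 3 * Nat.log 2 n + ((3 * L + 2 * ‖f‖) * 3 + 2 * L + L + ‖f‖)) / n := by
    push_cast
    ring
  linarith

end Convergence

end SuperPlancherel

theorem mainTheorem9 {K : Type*} [Field K] [Fintype K] (θ : AddChar K ℂ) (hθ : θ ≠ 1) :
    (∃! P : Measure (SuperPlancherel.InfinitePath θ), SuperPlancherel.IsPathMeasure θ P) ∧
    (∀ P : Measure (SuperPlancherel.InfinitePath θ), SuperPlancherel.IsPathMeasure θ P →
      (∀ (n : ℕ) (π : SuperPlancherel.SetPartition n),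
        ((P.real {w | w.1 n = π} : ℝ) : ℂ) = SuperPlancherel.SPl θ π) ∧
      ∀ᵐ w ∂P, Tendsto (fun n => SuperPlancherel.partitionMeasure (w.1 n)) atTop
        (𝓝 SuperPlancherel.limitMeasure)) ∧
    (∀ (E : Type*) [MeasurableSpace E] (P : Measure E) [IsProbabilityMeasure P]
      (X : (n : ℕ) → E → SuperPlancherel.SetPartition n),
      (∀ n, 1 ≤ n → Measurable (X n)) →
      (∀ n, 1 ≤ n → ∀ π : SuperPlancherel.SetPartition n,
        ((P.real {e | X n e = π} : ℝ) : ℂ) = SuperPlancherel.SPl θ π) →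
      ∀ᵐ e ∂P, Tendsto (fun n => SuperPlancherel.partitionMeasure (X n e)) atTop
        (𝓝 SuperPlancherel.limitMeasure)) := by
  open SuperPlancherel in
  obtain ⟨P, hP⟩ := exists_isPathMeasure θ hθ
  refine ⟨⟨P, hP, fun Q hQ => hQ.unique θ hθ hP⟩, fun P hP => ⟨fun n π => ?_, ?_⟩,
    fun E _ P _ X _ hX => ?_⟩
  · rw [SPl_eq_realSPl θ hθ, hP.measureReal_coord θ hθ]
  · have := hP.1
    filter_upwards [ae_eventually_isNearAntidiagonal K P (fun n w => w.1 n)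
      fun n _ π => hP.measureReal_coord θ hθ n π] with w hw
    exact tendsto_partitionMeasure w.1 hw
  · have hX' : ∀ n, 1 ≤ n → ∀ π : SetPartition n, P.real {e | X n e = π} = realSPl K π := by
      intro n hn π
      have := hX n hn π
      rw [SPl_eq_realSPl θ hθ] at this
      exact_mod_cast this
    filter_upwards [ae_eventually_isNearAntidiagonal K P X hX'] with e he
    exact tendsto_partitionMeasure _ he
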